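/- Let $E=(E^0,E^1,r,s)$ be a finite quiver, and let $\le$ be a pre-order on $E^0$ such that $v\le w$ whenever there is a (directed) path from $w$ to $v$. Let $I$ be the antisymmetrization of $(E^0,\le)$ with its induced partial order, and write $[v]\in I$ for the class of $v\in E^0$. Assume that $I$ is a tree, i.e. $I$ has a maximum $i_0$ and for every $i\in I$ the interval $[i,i_0]$ is a chain. Let $\mathbf K=\{K_i\}_{i\in I}$ be a poset of fields, i.e. a family of fields with compatible embeddings $K_j\subseteq K_i$ whenever $i\le j$. Let $P_{\mathbf K}((E))$ be the ring of formal power series $\sum_{\gamma} a_\gamma\gamma$ over all paths $\gamma$ of $E$ (the vertices being the paths of length $0$), with $a_\gamma\in K_{[r(\gamma)]}$ and the usual multiplication (the coefficient of $\gamma$ in $ab$ is $\sum_{\gamma=\alpha\beta}a_\alpha b_\beta$); let $P_{\mathbf K}(E)$ be its subring of series with finite support; and let $\epsilon\colon P_{\mathbf K}((E))\to\mathcal E=\bigoplus_{v\in E^0}K_{[v]}v$ be the augmentation, which keeps the coefficients at the paths of length $0$. Let $\Sigma$ be the set of all square matrices over $P_{\mathbf K}(E)$ that are sent by $\epsilon$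 to invertible matrices over $\mathcal E$, and let $P_{\mathbf K}(E)\Sigma^{-1}$ be the universal localization. For a field $K$ and a finite quiver $F$, let $P_K((F))$ and $P_K(F)$ be the usual power series and path algebras (all coefficients in $K$) and let $P^{\rm rat}_K(F)$ be the division closure of $P_K(F)$ in $P_K((F))$, i.e. the smallest subring that contains $P_K(F)$ and contains the inverse of each of its elements that is invertible in $P_K((F))$. For $i\in I$ let $E_{I\downarrow i}$ be the full subquiver of $E$ on the vertices $v$ with $[v]\le i$; then $P_{K_i}((E_{I\downarrow i}))\subseteq P_{\mathbf K}((E))$. For non-empty lower subsets $J$ of $I$, define additive subgroups $P^{\rm rat}_J(E)\subseteq P_{\mathbf K}((E))$ inductively: if $J$ consists of minimal elements of $I$, then $P^{\rm rat}_J(E)=\bigoplus_{i\in J}P^{\rm rat}_{K_i}(E_{I\downarrow i})$ (and here $E_{I\downarrow i}=E_{\{i\}}$); and if $J\ne I$, $i$ is a minimal element of $I\setminus J$ and $J'=J\cup\{i\}$, then $$P^{\rm rat}_{J'}(E)=P^{\rm rat}_{K_i}(E_{I\downarrow i})+P^{\rm rat}_{K_i}(E_{I\downarrow i})\,P^{\rm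 rat}_J(E)+P^{\rm rat}_J(E),$$ where the product denotes the set of finite sums of products. Put $P^{\rm rat}_{\mathbf K}(E):=P^{\rm rat}_I(E)$. Then $P^{\rm rat}_{\mathbf K}(E)$ is well defined (independent of the choices made in the induction), it is a subring of $P_{\mathbf K}((E))$, and it is the rational closure of $P_{\mathbf K}(E)$ in $P_{\mathbf K}((E))$, i.e. the smallest subring $T\supseteq P_{\mathbf K}(E)$ such that every square matrix over $T$ that is invertible over $P_{\mathbf K}((E))$ has its inverse over $T$. Moreover there is a unique ring homomorphism $P_{\mathbf K}(E)\Sigma^{-1}\to P^{\rm rat}_{\mathbf K}(E)$ compatible with the canonical maps from $P_{\mathbf K}(E)$, and it is an isomorphism. -/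

import Mathlib

universe u v w

namespace PosetFields

section RingTheory

/-- A subring `T` of `S` is *division closed* if the inverse in `S` of every element of `T` that is
invertible in `S` lies in `T`. -/
def IsDivisionClosed {S : Type u} [Ring S] (T : Subring S) : Prop :=
  ∀ x ∈ T, ∀ y : S, x * y = 1 → y * x = 1 → y ∈ T

/-- A subring `T` of `S` is *rationally closed* if the inverse over `S` of every square matrix over
`T` that is invertible over `S` has all its entries in `T`. -/
def IsRationallyClosed {S : Type u} [Ring S] (T : Subring S) : Prop :=
  ∀ (n : ℕ) (A B : Matrix (Fin n) (Fin n) S), (∀ i j, A i j ∈ T) → A * B = 1 → B * A = 1 →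
    ∀ i j, B i j ∈ T

/-- The division closure of `R` in `S`: the smallest division closed subring containing `R`. -/
def divisionClosure {S : Type u} [Ring S] (R : Subring S) : Subring S :=
  sInf {T | R ≤ T ∧ IsDivisionClosed T}

/-- The rational closure of `R` in `S`: the smallest rationally closed subring containing `R`. -/
def rationalClosure {S : Type u} [Ring S] (R : Subring S) : Subring S :=
  sInf {T | R ≤ T ∧ IsRationallyClosed T}

/-! The universal localization `R Σ⁻¹` of a ring at a set `Σ` of square matrices, by generators and
relations. -/

/-- Generators of `R Σ⁻¹`: the elements of `R`, and the entries of a formal inverse of each matrix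
in `Σ`. -/
inductive LocGen (R : Type u) (Sig : ∀ n : ℕ, Set (Matrix (Fin n) (Fin n) R)) : Type u
  | coeff (r : R) : LocGen R Sig
  | inv (n : ℕ) (A : Sig n) (i j : Fin n) : LocGen R Sig

open LocGen in
/-- Relations of `R Σ⁻¹`: those of `R`, and those saying that the formal inverses are two-sided
inverses. -/
inductive LocRel (R : Type u) [Ring R] (Sig : ∀ n : ℕ, Set (Matrix (Fin n) (Fin n) R)) :
    FreeAlgebra ℤ (LocGen R Sig) → FreeAlgebra ℤ (LocGen R Sig) → Prop
  | one : LocRel R Sig (FreeAlgebra.ι ℤ (coeff 1)) 1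
  | add (r s : R) : LocRel R Sig (FreeAlgebra.ι ℤ (coeff (r + s)))
      (FreeAlgebra.ι ℤ (coeff r) + FreeAlgebra.ι ℤ (coeff s))
  | mul (r s : R) : LocRel R Sig (FreeAlgebra.ι ℤ (coeff (r * s)))
      (FreeAlgebra.ι ℤ (coeff r) * FreeAlgebra.ι ℤ (coeff s))
  | mul_inv (n : ℕ) (A : Sig n) (i j : Fin n) : LocRel R Sig
      (∑ k, FreeAlgebra.ι ℤ (coeff (A.1 i k)) * FreeAlgebra.ι ℤ (inv n A k j))
      (if i = j then 1 else 0)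
  | inv_mul (n : ℕ) (A : Sig n) (i j : Fin n) : LocRel R Sig
      (∑ k, FreeAlgebra.ι ℤ (inv n A i k) * FreeAlgebra.ι ℤ (coeff (A.1 k j)))
      (if i = j then 1 else 0)

/-- The universal localization `R Σ⁻¹`. -/
abbrev UnivLoc (R : Type u) [Ring R] (Sig : ∀ n : ℕ, Set (Matrix (Fin n) (Fin n) R)) : Type u :=
  RingQuot (LocRel R Sig)

/-- The canonical ring homomorphism `R → R Σ⁻¹`. -/
noncomputable def UnivLoc.of {R : Type u} [Ring R]
    (Sig : ∀ n : ℕ, Set (Matrix (Fin n) (Fin n) R)) : R →+* UnivLoc R Sig :=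
  RingHom.mk'
    { toFun := fun r => RingQuot.mkRingHom (LocRel R Sig) (FreeAlgebra.ι ℤ (LocGen.coeff r))
      map_one' := by rw [RingQuot.mkRingHom_rel LocRel.one, map_one]
      map_mul' := fun r s => by rw [RingQuot.mkRingHom_rel (LocRel.mul r s), map_mul] }
    (fun r s => by
      change RingQuot.mkRingHom (LocRel R Sig) _ = RingQuot.mkRingHom (LocRel R Sig) _ +
        RingQuot.mkRingHom (LocRel R Sig) _
      rw [RingQuot.mkRingHom_rel (LocRel.add r s), map_add])

end RingTheory

/-- A poset `I` is a *tree* if it has a maximum `i₀` and every interval `[i, i₀]` is a chain. -/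
def IsTreePoset (I : Type u) [PartialOrder I] : Prop :=
  ∃ i₀ : I, IsTop i₀ ∧ ∀ i : I, IsChain (· ≤ ·) (Set.Icc i i₀)

/-- A poset of fields over `I`: fields `K_i` with compatible embeddings `K_j ⊆ K_i` for `i ≤ j`. -/
structure PosetOfFields (I : Type u) [PartialOrder I] where
  fld : I → Type w
  [field : ∀ i, Field (fld i)]
  incl : ∀ {i j : I}, i ≤ j → fld j →+* fld i
  incl_refl : ∀ (i : I) (x : fld i), incl (le_refl i) x = x
  incl_trans : ∀ {i j k : I} (hij : i ≤ j) (hjk : j ≤ k) (x : fld k),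
    incl hij (incl hjk x) = incl (hij.trans hjk) x

attribute [instance] PosetOfFields.field

/-- The constant poset of fields. -/
def PosetOfFields.const (I : Type u) [PartialOrder I] (F : Type w) [Field F] :
    PosetOfFields.{u, w} I where
  fld := fun _ => F
  incl := fun _ => RingHom.id F
  incl_refl := fun _ _ => rfl
  incl_trans := fun _ _ _ => rfl

/-- The pre-order on the vertices is compatible with the quiver: `x ≤ y` whenever there is a path
from `y` to `x`. -/
class PathCompatible (V : Type u) [Quiver.{v} V] [Preorder V] : Prop where
  le_of_path : ∀ {y x : V}, Quiver.Path y x → x ≤ y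

/-- The poset `I`: the antisymmetrization of the set of vertices. -/
abbrev Comp (V : Type u) [Preorder V] : Type u := Antisymmetrization V (· ≤ ·)

/-- The component `[x]` of a vertex. -/
abbrev comp {V : Type u} [Preorder V] (x : V) : Comp V := toAntisymmetrization (· ≤ ·) x

section Splits

variable {V : Type u} [Quiver.{v} V]

/-- The list of all factorizations `γ = α β` of a path (see `mem_splits` and `nodup_splits`). -/
def splits {x : V} : ∀ {y : V}, Quiver.Path x y → List (Σ z : V, Quiver.Path x z × Quiver.Path z y)
  | _, .nil => [⟨x, .nil, .nil⟩]
  | _, .cons p e => ⟨_, .cons p e, .nil⟩ ::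
      (splits p).map (fun s => ⟨s.1, s.2.1, s.2.2.cons e⟩)

theorem mem_splits {x y : V} (γ : Quiver.Path x y)
    (s : Σ z : V, Quiver.Path x z × Quiver.Path z y) :
    s ∈ splits γ ↔ s.2.1.comp s.2.2 = γ := by
  induction γ with
  | nil =>
    obtain ⟨z, α, β⟩ := s
    simp only [splits, List.mem_singleton]
    constructor
    · rintro h
      cases h
      rfl
    · intro h
      cases β with
      | nil => cases h; rfl
      | cons β e => cases h
  | cons p e ih =>
    obtain ⟨z, α, β⟩ := s
    simp only [splits, List.mem_cons, List.mem_map]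
    constructor
    · rintro (h | ⟨⟨z', α', β'⟩, h1, h2⟩)
      · cases h
        rfl
      · cases h2
        have := (ih ⟨z', α', β'⟩).1 h1
        simp only at this
        simp [Quiver.Path.comp_cons, this]
    · intro h
      cases β with
      | nil => left; cases h; rfl
      | cons β f =>
        right
        simp only [Quiver.Path.comp_cons] at h
        cases h
        exact ⟨⟨z, α, β⟩, (ih _).2 rfl, rfl⟩

theorem nodup_splits {x y : V} (γ : Quiver.Path x y) : (splits γ).Nodup := by
  induction γ with
  | nil => simp [splits]
  | cons p e ih =>
    rw [splits, List.nodup_cons]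
    constructor
    · simp only [List.mem_map, not_exists, not_and]
      rintro ⟨z, α, β⟩ - h
      have h1 := congrArg (fun s : (Σ z : V, Quiver.Path _ z × Quiver.Path z _) =>
        s.2.2.length) h
      simp at h1
    · refine ih.map ?_
      rintro ⟨z, α, β⟩ ⟨z', α', β'⟩ h
      simp only [Sigma.mk.injEq] at h
      obtain ⟨rfl, h⟩ := h
      have h := eq_of_heq h
      simp only [Prod.mk.injEq] at h
      obtain ⟨rfl, h⟩ := h
      cases h
      rfl

theorem sum_splits_assoc {M : Type w} [AddCommMonoid M] {x y : V} (γ : Quiver.Path x y)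
    (f : ∀ z t : V, Quiver.Path x z → Quiver.Path z t → Quiver.Path t y → M) :
    ((splits γ).map fun s => ((splits s.2.1).map fun t => f t.1 s.1 t.2.1 t.2.2 s.2.2).sum).sum =
    ((splits γ).map fun s => ((splits s.2.2).map fun t => f s.1 t.1 s.2.1 t.2.1 t.2.2).sum).sum := by
  induction γ with
  | nil => simp [splits]
  | cons p e ih =>
    simp only [splits, List.map_cons, List.sum_cons, List.map_map, Function.comp_def,
      List.map_nil, List.sum_nil, add_zero, List.sum_map_add]
    rw [ih (fun z t α β δ => f z t α β (δ.cons e)), add_assoc]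

theorem sum_splits_left {M : Type w} [AddCommMonoid M] {x y : V} (γ : Quiver.Path x y)
    (f : ∀ z : V, Quiver.Path x z → Quiver.Path z y → M)
    (hf : ∀ (z t : V) (α : Quiver.Path x z) (e : z ⟶ t) (β : Quiver.Path t y),
      f t (α.cons e) β = 0) :
    ((splits γ).map fun s => f s.1 s.2.1 s.2.2).sum = f x .nil γ := by
  induction γ with
  | nil => simp [splits]
  | cons p e ih =>
    simp only [splits, List.map_cons, List.sum_cons, List.map_map, Function.comp_def]
    rw [hf, zero_add]
    exact ih (fun z α β => f z α (β.cons e)) (fun z t α e' β => hf z t α e' (β.cons e))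

theorem sum_splits_right {M : Type w} [AddCommMonoid M] {x y : V} (γ : Quiver.Path x y)
    (f : ∀ z : V, Quiver.Path x z → Quiver.Path z y → M)
    (hf : ∀ (z t : V) (α : Quiver.Path x z) (β : Quiver.Path z t) (e : t ⟶ y),
      f z α (β.cons e) = 0) :
    ((splits γ).map fun s => f s.1 s.2.1 s.2.2).sum = f y γ .nil := by
  cases γ with
  | nil => simp [splits]
  | cons p e =>
    simp only [splits, List.map_cons, List.sum_cons, List.map_map, Function.comp_def]
    rw [List.map_congr_left (g := fun _ => (0 : M)) (fun s _ => hf _ _ _ _ _)]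
    simp

end Splits

section Series

variable {V : Type u} [Quiver.{v} V] [Preorder V]

theorem comp_le_of_path [PathCompatible V] {x y : V} (γ : Quiver.Path x y) : comp y ≤ comp x :=
  toAntisymmetrization_le_toAntisymmetrization_iff.2 (PathCompatible.le_of_path γ)

/-- `P_K((E))`: the formal power series `∑ a_γ γ` over all paths `γ` of `E`, with
`a_γ ∈ K_[r(γ)]`. -/
def PathSeries (K : PosetOfFields.{u, w} (Comp V)) : Type (max u v w) :=
  ∀ x y : V, Quiver.Path x y → K.fld (comp y)

namespace PathSeries

variable (K : PosetOfFields.{u, w} (Comp V))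

instance : AddCommGroup (PathSeries K) :=
  inferInstanceAs (AddCommGroup (∀ x y : V, Quiver.Path x y → K.fld (comp y)))

variable {K}

@[ext]
theorem ext {a b : PathSeries K} (h : ∀ (x y : V) (γ : Quiver.Path x y), a x y γ = b x y γ) :
    a = b :=
  funext fun x => funext fun y => funext fun γ => h x y γ

@[simp] theorem add_apply (a b : PathSeries K) (x y : V) (γ : Quiver.Path x y) :
    (a + b) x y γ = a x y γ + b x y γ := rfl

@[simp] theorem zero_apply (x y : V) (γ : Quiver.Path x y) : (0 : PathSeries K) x y γ = 0 := rfl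

@[simp] theorem neg_apply (a : PathSeries K) (x y : V) (γ : Quiver.Path x y) :
    (-a) x y γ = -a x y γ := rfl

variable (K) in
/-- The coefficients of `1 = ∑_v v`. -/
def oneCoeff : ∀ x y : V, Quiver.Path x y → K.fld (comp y)
  | _, _, .nil => 1
  | _, _, .cons _ _ => 0

instance : One (PathSeries K) := ⟨oneCoeff K⟩

@[simp] theorem one_nil (x : V) : (1 : PathSeries K) x x .nil = 1 := rfl

@[simp] theorem one_cons {x y z : V} (p : Quiver.Path x y) (e : y ⟶ z) :
    (1 : PathSeries K) x z (p.cons e) = 0 := rfl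

variable [PathCompatible V]

/-- The usual multiplication of power series:
the coefficient of `γ` in `a b` is the sum of `a_α b_β` over all factorizations `γ = α β`. -/
instance : Mul (PathSeries K) :=
  ⟨fun a b x y γ => ((splits γ).map fun s =>
    K.incl (comp_le_of_path s.2.2) (a x s.1 s.2.1) * b s.1 y s.2.2).sum⟩

theorem mul_apply (a b : PathSeries K) (x y : V) (γ : Quiver.Path x y) :
    (a * b) x y γ = ((splits γ).map fun s =>
      K.incl (comp_le_of_path s.2.2) (a x s.1 s.2.1) * b s.1 y s.2.2).sum := rfl

protected theorem mul_assoc (a b c : PathSeries K) : a * b * c = a * (b * c) := by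
  ext x y γ
  simp only [mul_apply, map_list_sum, List.map_map, Function.comp_def, map_mul, K.incl_trans,
    ← List.sum_map_mul_left, ← List.sum_map_mul_right, mul_assoc]
  exact sum_splits_assoc γ (fun z t α β δ => K.incl (comp_le_of_path (β.comp δ)) (a x z α) *
    (K.incl (comp_le_of_path δ) (b z t β) * c t y δ))

protected theorem mul_one (a : PathSeries K) : a * 1 = a := by
  ext x y γ
  have h := sum_splits_right γ (fun z α β => K.incl (comp_le_of_path β) (a x z α) *
    (1 : PathSeries K) z y β) (fun z t α β e => by rw [one_cons, mul_zero])
  rw [mul_apply, h, one_nil, K.incl_refl, mul_one]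

protected theorem one_mul (a : PathSeries K) : 1 * a = a := by
  ext x y γ
  have h := sum_splits_left γ (fun z α β => K.incl (comp_le_of_path β)
    ((1 : PathSeries K) x z α) * a z y β)
    (fun z t α e β => by rw [one_cons, map_zero, zero_mul])
  rw [mul_apply, h, one_nil, map_one, one_mul]

instance : Ring (PathSeries K) :=
  { (inferInstance : AddCommGroup (PathSeries K)) with
    mul := (· * ·)
    one := 1
    mul_assoc := PathSeries.mul_assoc
    mul_one := PathSeries.mul_one
    one_mul := PathSeries.one_mul
    zero_mul := fun a => by ext x y γ; simp [mul_apply]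
    mul_zero := fun a => by ext x y γ; simp [mul_apply]
    left_distrib := fun a b c => by
      ext x y γ; simp [mul_apply, mul_add, List.sum_map_add]
    right_distrib := fun a b c => by
      ext x y γ; simp [mul_apply, add_mul, List.sum_map_add] }

/-- The set of paths whose coefficient is not zero. -/
def support (a : PathSeries K) : Set (Σ x y : V, Quiver.Path x y) :=
  {p | a p.1 p.2.1 p.2.2 ≠ 0}

theorem finite_support_mul {a b : PathSeries K} (ha : a.support.Finite) (hb : b.support.Finite) :
    (a * b).support.Finite := by
  classical
  let g : (Σ x y : V, Quiver.Path x y) × (Σ x y : V, Quiver.Path x y) →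
      (Σ x y : V, Quiver.Path x y)
    | (⟨x, z, α⟩, ⟨z', y, β⟩) => if h : z' = z then ⟨x, y, α.comp (h ▸ β)⟩ else ⟨x, z, α⟩
  refine ((ha.prod hb).image g).subset ?_
  rintro ⟨x, y, γ⟩ hγ
  have hne : (a * b) x y γ ≠ 0 := hγ
  rw [mul_apply] at hne
  obtain ⟨c, hc, hc0⟩ : ∃ c ∈ (splits γ).map (fun s :
      (Σ z : V, Quiver.Path x z × Quiver.Path z y) => K.incl (comp_le_of_path s.2.2) (a x s.1 s.2.1) * b s.1 y s.2.2), c ≠ 0 := by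
    by_contra! h
    exact hne (List.sum_eq_zero h)
  obtain ⟨⟨z, α, β⟩, hs, rfl⟩ := List.mem_map.1 hc
  have hcomp := (mem_splits γ _).1 hs
  refine ⟨(⟨x, z, α⟩, ⟨z, y, β⟩), ⟨?_, ?_⟩, ?_⟩
  · intro h0
    exact hc0 (by
      change K.incl _ (a x z α) * _ = 0
      rw [show a x z α = 0 from h0, map_zero, zero_mul])
  · intro h0
    exact hc0 (by
      change _ * b z y β = 0
      rw [show b z y β = 0 from h0, mul_zero])
  · simpa [g] using hcomp

end PathSeries

variable [PathCompatible V] (K : PosetOfFields.{u, w} (Comp V))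

/-- The path algebra `P_K(E)`: the subring of `P_K((E))` of the series with finite support. -/
def pathAlgebra [Finite V] : Subring (PathSeries K) where
  carrier := {a | a.support.Finite}
  mul_mem' := PathSeries.finite_support_mul
  one_mem' := by
    refine (Set.finite_range fun x : V =>
      (⟨x, x, .nil⟩ : Σ x y : V, Quiver.Path x y)).subset ?_
    rintro ⟨x, y, γ⟩ h
    cases γ with
    | nil => exact ⟨x, rfl⟩
    | cons p e => exact absurd rfl h
  add_mem' := fun {a b} ha hb => by
    refine (Set.Finite.union ha hb).subset fun p hp => ?_
    by_contra h
    simp only [Set.mem_union, PathSeries.support, Set.mem_ofPred_eq, not_or, not_not] at h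
    exact hp (by rw [PathSeries.add_apply, h.1, h.2, add_zero])
  zero_mem' := Set.finite_empty.subset fun _ hp => hp rfl
  neg_mem' := fun {a} ha => Set.Finite.subset ha fun p hp => by
    intro h
    exact hp (by rw [PathSeries.neg_apply, h, neg_zero])

/-- The augmentation `ε : P_K((E)) → 𝓔 = ⊕_v K_[v] v`, taking the coefficients at the trivial
paths. As `E⁰` is finite, `𝓔` is the product ring `∏_v K_[v]`. -/
def augmentation : PathSeries K →+* (∀ x : V, K.fld (comp x)) where
  toFun := fun a x => a x x .nil
  map_one' := rfl
  map_mul' := fun a b => by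
    funext x
    simp [PathSeries.mul_apply, splits, K.incl_refl]
  map_zero' := rfl
  map_add' := fun _ _ => rfl

/-- The set `Σ` of the square matrices over `P_K(E)` that `ε` sends to invertible matrices. -/
def sigmaSet [Finite V] (n : ℕ) : Set (Matrix (Fin n) (Fin n) (pathAlgebra K)) :=
  {A | IsUnit (A.map fun a => augmentation K (a : PathSeries K))}

/-- For a field `F`: `P_F((E))`, with all the coefficients in `F`. -/
abbrev FieldSeries (V : Type u) [Quiver.{v} V] [Preorder V] (F : Type w) [Field F] :
    Type (max u v w) :=
  PathSeries (V := V) (PosetOfFields.const (Comp V) F)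

/-- For a field `F`: the algebra of rational series `P^rat_F(E)`, the division closure of `P_F(E)`
in `P_F((E))`. -/
def fieldRat (V : Type u) [Quiver.{v} V] [Preorder V] [PathCompatible V] [Finite V]
    (F : Type w) [Field F] : Subring (FieldSeries V F) :=
  divisionClosure (pathAlgebra (V := V) (PosetOfFields.const (Comp V) F))

end Series

section Restriction

variable {V : Type u} [Quiver.{v} V] [Preorder V]

/-- The vertices of the restriction graph `E_{I↓i}`: those `x` with `[x] ≤ i`. -/
structure Below (i : Comp V) : Type u where
  val : V
  le : comp val ≤ i

/-- The edges of the restriction graph `E_{I↓i}`: the edges of `E` between its vertices. -/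
instance (i : Comp V) : Quiver.{v} (Below i) := ⟨fun x y => (x.val ⟶ y.val)⟩

instance (i : Comp V) : Preorder (Below i) := Preorder.lift Below.val

instance (i : Comp V) [Finite V] : Finite (Below i) :=
  Finite.of_injective Below.val fun ⟨_, _⟩ ⟨_, _⟩ h => by cases h; rfl

/-- A path of `E_{I↓i}`, as a path of `E`. -/
def Below.path {i : Comp V} {x : Below i} : ∀ {y : Below i},
    Quiver.Path x y → Quiver.Path x.val y.val
  | _, .nil => .nil
  | _, .cons p e => .cons (Below.path p) e

variable [PathCompatible V]

instance (i : Comp V) : PathCompatible (Below i) :=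
  ⟨fun {y x} γ => (PathCompatible.le_of_path (Below.path γ) : x.val ≤ y.val)⟩

/-- A path of `E` that starts in `E_{I↓i}`, as a path of `E_{I↓i}`. -/
def Below.lift {i : Comp V} {x : V} (hx : comp x ≤ i) : ∀ {y : V} (γ : Quiver.Path x y),
    Quiver.Path (⟨x, hx⟩ : Below i) ⟨y, (comp_le_of_path γ).trans hx⟩
  | _, .nil => .nil
  | _, .cons p e => .cons (Below.lift hx p) e

variable (K : PosetOfFields.{u, w} (Comp V))

open Classical in
/-- A series in the paths of `E_{I↓i}` with coefficients in `K_i`, as a series in the paths of `E`,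
via `K_i ⊆ K_j` for `j ≤ i`. -/
noncomputable def extendFun (i : Comp V) (a : FieldSeries (Below i) (K.fld i)) : PathSeries K :=
  fun x y γ =>
    if hx : comp x ≤ i then
      K.incl ((comp_le_of_path γ).trans hx)
        (show K.fld i from a ⟨x, hx⟩ ⟨y, (comp_le_of_path γ).trans hx⟩ (Below.lift hx γ))
    else 0

/-- The inclusion `P_{K_i}((E_{I↓i})) ⊆ P_K((E))`. -/
noncomputable def extend (i : Comp V) : FieldSeries (Below i) (K.fld i) →+ PathSeries K where
  toFun := extendFun K i
  map_zero' := by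
    ext x y γ
    by_cases hx : comp x ≤ i
    · simp only [extendFun, dif_pos hx, PathSeries.zero_apply]
      exact map_zero (K.incl ((comp_le_of_path γ).trans hx))
    · simp only [extendFun, dif_neg hx, PathSeries.zero_apply]
  map_add' := fun a b => by
    ext x y γ
    by_cases hx : comp x ≤ i
    · simp only [extendFun, dif_pos hx, PathSeries.add_apply]
      exact map_add (K.incl ((comp_le_of_path γ).trans hx)) _ _
    · simp only [extendFun, dif_neg hx, PathSeries.add_apply, add_zero]

variable [Finite V]

/-- `P^rat_{K_i}(E_{I↓i})`, as an additive subgroup of `P_K((E))`. -/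
noncomputable def ratAt (i : Comp V) : AddSubgroup (PathSeries K) :=
  (fieldRat (Below i) (K.fld i)).toAddSubgroup.map (extend K i)

/-- The product `A B` of two additive subgroups: the finite sums of products `a b`. -/
def prodSpan {S : Type u} [Ring S] (A B : AddSubgroup S) : AddSubgroup S :=
  AddSubgroup.closure {x | ∃ a ∈ A, ∃ b ∈ B, x = a * b}

/-- The inductive definition of `P^rat_J(E) ⊆ P_K((E))` for non-empty lower subsets `J` of `I`:
`IsRat K J P` says that `P` is obtained as a value of `P^rat_J(E)`.

* If `J` is a non-empty set of minimal elements of `I`, then `P^rat_J(E)` is the sum of the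
  `P^rat_{K_i}(E_{i})` for `i ∈ J` (note `E_{i} = E_{I↓i}`).
* If `J` is a non-empty lower subset, `i` is minimal in `I \ J` and `J' = J ∪ {i}`, then
  `P^rat_{J'}(E) = P^rat_{K_i}(E_{I↓i}) + P^rat_{K_i}(E_{I↓i}) P^rat_J(E) + P^rat_J(E)`. -/
inductive IsRat : Set (Comp V) → AddSubgroup (PathSeries K) → Prop
  | base (J : Set (Comp V)) (hne : J.Nonempty) (hmin : ∀ i ∈ J, IsMin i) :
      IsRat J (⨆ i ∈ J, ratAt K i)
  | step (J : Set (Comp V)) (hne : J.Nonempty) (hlow : IsLowerSet J) (i : Comp V)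
      (hi : Minimal (fun j => j ∉ J) i) (P : AddSubgroup (PathSeries K)) (hP : IsRat J P) :
      IsRat (J ∪ {i}) (ratAt K i ⊔ prodSpan (ratAt K i) P ⊔ P)

end Restriction

end PosetFields

namespace PosetFields

/-! ### Linear representations c A⁻¹ d over a ring with a split augmentation. -/

section AbstractRational

variable {R Q T : Type*} [Ring R] [Ring Q] [Ring T]

/-! A series is rational exactly when it equals c A⁻¹ d, with c and d over 𝓔 and A a square matrix
over the path algebra, of degree at most one and with invertible augmentation. Block constructions
show that such expressions are stable under sums, products and inversion of matrices
(`IsRatMat.add`, `IsRatMat.mul`, `IsRatMat.inv`). They therefore exhaust both the rational closure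
(`ratSubring_eq_rationalClosure`) and the universal localization (`mem_ratSubring_univLoc`), and
surjectivity of the natural map follows.

For injectivity, normalize to c (1 - B)⁻¹ d with B homogeneous of degree one, and suppose that this
series is zero. At each vertex y, the coefficient rows of w = c (1 - B)⁻¹ at the paths ending at y
span a subspace that contains the value of c, is annihilated by d, and receives, along each arrow
into y, the subspace at the source of the arrow. Projections onto these subspaces form a matrix E
over 𝓔 with c E = c, E d = 0 and E B E = E B (`exists_invariant_projection`). Then E (1 - B) = (1 -
E B) E, so already in the localization c (1 - B)⁻¹ d = c (1 - E B)⁻¹ E d = 0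
(`eq_zero_of_map_eq_zero`).

The inductively defined groups are identified by a description free of choices: the value at J is
the group `ratOn` of rational series supported on paths starting in J. The key is `idem_mul_mem`.
Let q be the idempotent of the component i, let G = q c (1 - q B q)⁻¹, which is rational over
E_{I↓i}, and let N = q B (1 - q), which involves only the arrows leaving the component. Then q c (1
- B)⁻¹ = G + G N (1 - B)⁻¹. Splitting N into arrows, with their coefficients moved to the right,
produces the terms of the inductive formula. -/

theorem isUnit_matrix_of_mul_eq_one {n : Type*} [Fintype n] [DecidableEq n]
    {A B : Matrix n n T} (h₁ : A * B = 1) (h₂ : B * A = 1) : IsUnit A :=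
  ⟨⟨A, B, h₁, h₂⟩, rfl⟩

/-- A ring `R` with an augmentation onto `Q` split by `sec`, together with an additive subgroup
`lin` of `R` of linear elements, stable under left multiplication by `Q`. -/
structure LinearData (R Q : Type*) [Ring R] [Ring Q] where
  aug : R →+* Q
  sec : Q →+* R
  aug_sec : ∀ q, aug (sec q) = q
  lin : AddSubgroup R
  sec_mem : ∀ q, sec q ∈ lin
  sec_mul_mem : ∀ q, ∀ r ∈ lin, sec q * r ∈ lin

variable (L : LinearData R Q) (f : R →+* T)

/-- The matrices over `T` of the form `C A⁻¹ D`, where `C` and `D` have coefficients in `Q` and `A`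
is a matrix with linear coefficients whose augmentation is invertible. -/
def IsRatMat {m n : Type*} (P : Matrix m n T) : Prop :=
  ∃ (p : Type) (_ : Fintype p) (_ : DecidableEq p) (A : Matrix p p R) (X : Matrix p p T)
    (C : Matrix m p Q) (D : Matrix p n Q), (∀ i j, A i j ∈ L.lin) ∧ IsUnit (A.map L.aug) ∧
    A.map f * X = 1 ∧ X * A.map f = 1 ∧
    P = C.map (f.comp L.sec) * X * D.map (f.comp L.sec)

variable {L f}

theorem LinearData.map_sec_map_aug {m n : Type*} (C : Matrix m n Q) :
    (C.map L.sec).map L.aug = C := by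
  ext i j; simp [L.aug_sec]

theorem IsRatMat.mul_left {l m n : Type*} [Fintype m] {P : Matrix m n T}
    (hP : IsRatMat L f P) (C' : Matrix l m Q) : IsRatMat L f (C'.map (f.comp L.sec) * P) := by
  obtain ⟨p, _, _, A, X, C, D, hA, hU, h1, h2, rfl⟩ := hP
  refine ⟨p, _, _, A, X, C' * C, D, hA, hU, h1, h2, ?_⟩
  simp only [Matrix.map_mul, Matrix.mul_assoc]

theorem IsRatMat.mul_right {m n l : Type*} [Fintype n] {P : Matrix m n T}
    (hP : IsRatMat L f P) (D' : Matrix n l Q) : IsRatMat L f (P * D'.map (f.comp L.sec)) := by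
  obtain ⟨p, _, _, A, X, C, D, hA, hU, h1, h2, rfl⟩ := hP
  refine ⟨p, _, _, A, X, C, D * D', hA, hU, h1, h2, ?_⟩
  simp only [Matrix.map_mul, Matrix.mul_assoc]

theorem fromBlocks_upper_mul_inv {p q : Type*} [Fintype p] [Fintype q] [DecidableEq p]
    [DecidableEq q] {A X : Matrix p p T} {A' X' : Matrix q q T} (B : Matrix p q T)
    (h1 : A * X = 1) (h1' : A' * X' = 1) :
    Matrix.fromBlocks A B 0 A' * Matrix.fromBlocks X (-(X * B * X')) 0 X' = 1 := by
  have h : A * (X * (B * X')) = B * X' := by rw [← Matrix.mul_assoc, h1, Matrix.one_mul]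
  simp [Matrix.fromBlocks_multiply, h1, h1', Matrix.mul_assoc, h]

theorem fromBlocks_inv_mul_upper {p q : Type*} [Fintype p] [Fintype q] [DecidableEq p]
    [DecidableEq q] {A X : Matrix p p T} {A' X' : Matrix q q T} (B : Matrix p q T)
    (h1 : X * A = 1) (h1' : X' * A' = 1) :
    Matrix.fromBlocks X (-(X * B * X')) 0 X' * Matrix.fromBlocks A B 0 A' = 1 := by
  simp [Matrix.fromBlocks_multiply, h1, h1', Matrix.mul_assoc]

theorem isUnit_fromBlocks_upper {p q : Type*} [Fintype p] [Fintype q] [DecidableEq p]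
    [DecidableEq q] {A : Matrix p p T} {A' : Matrix q q T} (B : Matrix p q T)
    (h : IsUnit A) (h' : IsUnit A') : IsUnit (Matrix.fromBlocks A B 0 A') := by
  obtain ⟨⟨A, X, h1, h2⟩, rfl⟩ := h
  obtain ⟨⟨A', X', h1', h2'⟩, rfl⟩ := h'
  exact isUnit_matrix_of_mul_eq_one (fromBlocks_upper_mul_inv B h1 h1')
    (fromBlocks_inv_mul_upper B h2 h2')

/-- Direct sum of the two representations: block diagonal A, with C's side by side and D's stacked.
-/
theorem IsRatMat.add {m n : Type*} {P P' : Matrix m n T}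
    (hP : IsRatMat L f P) (hP' : IsRatMat L f P') : IsRatMat L f (P + P') := by
  obtain ⟨p, _, _, A, X, C, D, hA, hU, h1, h2, rfl⟩ := hP
  obtain ⟨p', _, _, A', X', C', D', hA', hU', h1', h2', rfl⟩ := hP'
  refine ⟨p ⊕ p', inferInstance, inferInstance, Matrix.fromBlocks A 0 0 A',
    Matrix.fromBlocks X 0 0 X', Matrix.fromCols C C', Matrix.fromRows D D', ?_, ?_, ?_, ?_, ?_⟩
  · rintro (i | i) (j | j)
    · exact hA i j
    · exact zero_mem _
    · exact zero_mem _
    · exact hA' i j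
  · rw [Matrix.fromBlocks_map]
    simpa using isUnit_fromBlocks_upper 0 hU hU'
  · simp [Matrix.fromBlocks_map, Matrix.fromBlocks_multiply, h1, h1']
  · simp [Matrix.fromBlocks_map, Matrix.fromBlocks_multiply, h2, h2']
  · have e1 : (Matrix.fromCols C C').map (f.comp L.sec) =
        Matrix.fromCols (C.map (f.comp L.sec)) (C'.map (f.comp L.sec)) := by
      ext i (j | j) <;> rfl
    have e2 : (Matrix.fromRows D D').map (f.comp L.sec) =
        Matrix.fromRows (D.map (f.comp L.sec)) (D'.map (f.comp L.sec)) := by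
      ext (i | i) j <;> rfl
    rw [e1, e2, Matrix.fromCols_mul_fromBlocks, Matrix.fromCols_mul_fromRows]
    simp

/-- The block triangular matrix with corner -D C' has X D C' X' in the corner of its inverse. The
corner stays linear because C' and D have coefficients in `Q`. -/
theorem IsRatMat.mul {m n l : Type*} [Fintype n] {P : Matrix m n T} {P' : Matrix n l T}
    (hP : IsRatMat L f P) (hP' : IsRatMat L f P') : IsRatMat L f (P * P') := by
  obtain ⟨p, _, _, A, X, C, D, hA, hU, h1, h2, rfl⟩ := hP
  obtain ⟨p', _, _, A', X', C', D', hA', hU', h1', h2', rfl⟩ := hP'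
  have hB : (-((D * C').map L.sec)).map f =
      -(D.map (f.comp L.sec) * C'.map (f.comp L.sec)) := by
    rw [← Matrix.map_mul]
    ext i j; simp only [Matrix.map_apply, Matrix.neg_apply, map_neg, RingHom.comp_apply]
  refine ⟨p ⊕ p', inferInstance, inferInstance,
    Matrix.fromBlocks A (-((D * C').map L.sec)) 0 A',
    Matrix.fromBlocks X (-(X * (-((D * C').map L.sec)).map f * X')) 0 X',
    Matrix.fromCols C 0, Matrix.fromRows 0 D', ?_, ?_, ?_, ?_, ?_⟩
  · rintro (i | i) (j | j)
    · exact hA i j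
    · exact neg_mem (L.sec_mem _)
    · exact zero_mem _
    · exact hA' i j
  · rw [Matrix.fromBlocks_map, Matrix.map_zero _ (map_zero _)]
    exact isUnit_fromBlocks_upper _ hU hU'
  · rw [Matrix.fromBlocks_map, Matrix.map_zero _ (map_zero _)]
    exact fromBlocks_upper_mul_inv _ h1 h1'
  · rw [Matrix.fromBlocks_map, Matrix.map_zero _ (map_zero _)]
    exact fromBlocks_inv_mul_upper _ h2 h2'
  · have e1 : (Matrix.fromCols C (0 : Matrix m p' Q)).map (f.comp L.sec) =
        Matrix.fromCols (C.map (f.comp L.sec)) 0 := by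
      ext i (j | j)
      · rfl
      · simp
    have e2 : (Matrix.fromRows (0 : Matrix p l Q) D').map (f.comp L.sec) =
        Matrix.fromRows 0 (D'.map (f.comp L.sec)) := by
      ext (i | i) j
      · simp
      · rfl
    rw [e1, e2, Matrix.fromCols_mul_fromBlocks, Matrix.fromCols_mul_fromRows, hB]
    simp [Matrix.mul_assoc]

/-- The unipotent matrix with corner -r is linear, and its inverse has corner r. -/
theorem isRatMat_of_mem_lin {r : R} (hr : r ∈ L.lin) :
    IsRatMat L f (Matrix.of fun _ _ : Unit => f r) := by
  have h1 : (1 : Matrix Unit Unit T) * 1 = 1 := Matrix.one_mul _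
  have hm : (Matrix.fromBlocks 1 (Matrix.of fun _ _ => -r) 0 1 :
      Matrix (Unit ⊕ Unit) (Unit ⊕ Unit) R).map f =
      Matrix.fromBlocks 1 (Matrix.of fun _ _ => -f r) 0 1 := by
    ext (i | i) (j | j) <;> simp
  refine ⟨Unit ⊕ Unit, inferInstance, inferInstance,
    Matrix.fromBlocks 1 (Matrix.of fun _ _ => -r) 0 1,
    Matrix.fromBlocks 1 (-(1 * (Matrix.of fun _ _ => -f r) * 1)) 0 1,
    Matrix.fromCols 1 0, Matrix.fromRows 0 1, ?_, ?_, ?_, ?_, ?_⟩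
  · rintro (i | i) (j | j)
    · simpa using L.sec_mem 1
    · exact neg_mem hr
    · exact zero_mem _
    · simpa using L.sec_mem 1
  · rw [Matrix.fromBlocks_map, Matrix.map_zero _ (map_zero _)]
    exact isUnit_fromBlocks_upper _ (by simp) (by simp)
  · rw [hm]
    exact fromBlocks_upper_mul_inv _ h1 h1
  · rw [hm]
    exact fromBlocks_inv_mul_upper _ h1 h1
  · ext i j
    simp [Matrix.mul_apply]

variable (L f) in
/-- The subring of the elements of `T` of the form `c A⁻¹ d`. -/
def ratSubring : Subring T where
  carrier := {t | IsRatMat L f (Matrix.of fun _ _ : Unit => t)}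
  mul_mem' {a b} ha hb := by
    have h : (Matrix.of fun _ _ : Unit => a * b) =
        (Matrix.of fun _ _ : Unit => a) * Matrix.of fun _ _ : Unit => b := by
      ext; simp [Matrix.mul_apply]
    change IsRatMat L f (Matrix.of fun _ _ : Unit => a * b)
    rw [h]
    exact IsRatMat.mul ha hb
  one_mem' := by
    simpa using isRatMat_of_mem_lin (L := L) (f := f) (L.sec_mem 1)
  add_mem' {a b} ha hb := IsRatMat.add ha hb
  zero_mem' := by
    simpa using isRatMat_of_mem_lin (L := L) (f := f) (L.sec_mem 0)
  neg_mem' {a} ha := by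
    have h : (Matrix.of fun _ _ : Unit => -a) =
        (Matrix.of fun _ _ : Unit => (-1 : Q)).map (f.comp L.sec) *
          Matrix.of fun _ _ : Unit => a := by
      ext; simp [Matrix.mul_apply]
    change IsRatMat L f (Matrix.of fun _ _ : Unit => -a)
    rw [h]
    exact IsRatMat.mul_left ha _

theorem mem_ratSubring {t : T} :
    t ∈ ratSubring L f ↔ IsRatMat L f (Matrix.of fun _ _ : Unit => t) := Iff.rfl

theorem mem_ratSubring_of_mem_lin {r : R} (hr : r ∈ L.lin) : f r ∈ ratSubring L f :=
  isRatMat_of_mem_lin hr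

theorem IsRatMat.apply_mem {m n : Type*} {P : Matrix m n T} (hP : IsRatMat L f P) (i : m) (j : n) :
    P i j ∈ ratSubring L f := by
  obtain ⟨p, _, _, A, X, C, D, hA, hU, h1, h2, rfl⟩ := hP
  exact ⟨p, _, _, A, X, C.submatrix (fun _ => i) id, D.submatrix id (fun _ => j), hA, hU, h1, h2,
    by ext; simp [Matrix.mul_apply]⟩

theorem IsRatMat.zero {m n : Type*} : IsRatMat L f (0 : Matrix m n T) :=
  ⟨Empty, inferInstance, inferInstance, 0, 0, 0, 0, fun i => i.elim,
    by rw [Subsingleton.elim (Matrix.map _ _) 1]; exact isUnit_one,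
    Subsingleton.elim _ _, Subsingleton.elim _ _, by ext; simp [Matrix.mul_apply]⟩

/-- A matrix is the sum of its entries placed by rows and columns of matrix units, which have
coefficients in `Q`. -/
theorem isRatMat_of_apply_mem {m n : Type*} [Fintype m] [Fintype n] {P : Matrix m n T}
    (hP : ∀ i j, P i j ∈ ratSubring L f) : IsRatMat L f P := by
  classical
  have hsum : P = ∑ ij : m × n, ((Matrix.of fun (k : m) (_ : Unit) =>
      if k = ij.1 then (1 : Q) else 0).map (f.comp L.sec) *
      (Matrix.of fun _ _ : Unit => P ij.1 ij.2)) *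
      (Matrix.of fun (_ : Unit) (k : n) => if k = ij.2 then (1 : Q) else 0).map (f.comp L.sec) := by
    ext i j
    rw [Matrix.sum_apply, Fintype.sum_prod_type, Finset.sum_eq_single i, Finset.sum_eq_single j]
    · simp [Matrix.mul_apply]
    · intro b _ hb
      simp [Matrix.mul_apply, hb.symm]
    · simp
    · intro b _ hb
      simp [Matrix.mul_apply, hb.symm]
    · simp
  rw [hsum]
  refine Finset.sum_induction _ (IsRatMat L f) (fun _ _ => IsRatMat.add) IsRatMat.zero
    fun ij _ => ?_
  exact ((mem_ratSubring.1 (hP ij.1 ij.2)).mul_left _).mul_right _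

/-- The Schur complement of A in this bordered matrix is C A⁻¹ D, so the inverse of C A⁻¹ D appears
as a corner. This realizes inversion without leaving linear matrices. -/
theorem fromBlocks_schur_mul_inv {p n : Type*} [Fintype p] [Fintype n] [DecidableEq p]
    [DecidableEq n] {A X : Matrix p p T} {C : Matrix n p T} {D : Matrix p n T} {Y : Matrix n n T}
    (h1 : A * X = 1) (hY : C * X * D * Y = 1) :
    Matrix.fromBlocks A D (-C) 0 *
      Matrix.fromBlocks (X - X * D * Y * C * X) (-(X * D * Y)) (Y * C * X) Y = 1 := by
  have h1' (Z : Matrix p n T) : A * (X * Z) = Z := by rw [← Matrix.mul_assoc, h1, Matrix.one_mul]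
  have h1'' (Z : Matrix p p T) : A * (X * Z) = Z := by rw [← Matrix.mul_assoc, h1, Matrix.one_mul]
  have hY' (Z : Matrix n p T) : C * (X * (D * (Y * Z))) = Z := by
    rw [← Matrix.mul_assoc, ← Matrix.mul_assoc, ← Matrix.mul_assoc, hY, Matrix.one_mul]
  have hY'' : C * (X * (D * Y)) = 1 := by
    rw [← Matrix.mul_assoc, ← Matrix.mul_assoc, hY]
  simp [Matrix.fromBlocks_multiply, Matrix.mul_assoc, Matrix.mul_sub, h1, h1', h1'', hY', hY'']

theorem fromBlocks_inv_mul_schur {p n : Type*} [Fintype p] [Fintype n] [DecidableEq p]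
    [DecidableEq n] {A X : Matrix p p T} {C : Matrix n p T} {D : Matrix p n T} {Y : Matrix n n T}
    (h1 : X * A = 1) (hY : Y * (C * X * D) = 1) :
    Matrix.fromBlocks (X - X * D * Y * C * X) (-(X * D * Y)) (Y * C * X) Y *
      Matrix.fromBlocks A D (-C) 0 = 1 := by
  have hY' : Y * (C * (X * D)) = 1 := by rw [← Matrix.mul_assoc C, hY]
  simp [Matrix.fromBlocks_multiply, Matrix.mul_assoc, Matrix.sub_mul, h1, hY']

/-- Y is the lower right corner of the inverse of the bordered matrix. That matrix is invertible
over `T`, and applying `augT` shows that its augmentation is invertible over `Q`; this is where an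
augmentation on `T` is needed. -/
theorem IsRatMat.inv {n : Type} [Fintype n] [DecidableEq n] {P Y : Matrix n n T}
    (hP : IsRatMat L f P) (augT : T →+* Q)
    (haug : ∀ r, augT (f r) = L.aug r) (h1 : P * Y = 1) (h2 : Y * P = 1) : IsRatMat L f Y := by
  obtain ⟨p, _, _, A, X, C, D, hA, hU, hX1, hX2, rfl⟩ := hP
  have hm : (Matrix.fromBlocks A (D.map L.sec) (-(C.map L.sec)) 0).map f =
      Matrix.fromBlocks (A.map f) (D.map (f.comp L.sec)) (-(C.map (f.comp L.sec))) 0 := by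
    ext (i | i) (j | j) <;> simp
  have g1 := fromBlocks_schur_mul_inv hX1 h1
  have g2 := fromBlocks_inv_mul_schur hX2 h2
  rw [← hm] at g1 g2
  refine ⟨p ⊕ n, inferInstance, inferInstance, _, _, Matrix.fromCols 0 1, Matrix.fromRows 0 1,
    ?_, ?_, g1, g2, ?_⟩
  · rintro (i | i) (j | j)
    · exact hA i j
    · exact L.sec_mem _
    · exact neg_mem (L.sec_mem _)
    · exact zero_mem _
  · have h := (isUnit_matrix_of_mul_eq_one g1 g2).map augT.mapMatrix
    have e1 : augT.mapMatrix ((Matrix.fromBlocks A (D.map L.sec) (-(C.map L.sec)) 0).map f) =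
        (Matrix.fromBlocks A (D.map L.sec) (-(C.map L.sec)) 0).map L.aug := by
      ext i j
      simp [haug]
    rwa [e1] at h
  · have e1 : (Matrix.fromCols (0 : Matrix n p Q) (1 : Matrix n n Q)).map (f.comp L.sec) =
        Matrix.fromCols 0 1 := by
      ext i (j | j) <;> simp [Matrix.one_apply, apply_ite f, apply_ite L.sec]
    have e2 : (Matrix.fromRows (0 : Matrix p n Q) (1 : Matrix n n Q)).map (f.comp L.sec) =
        Matrix.fromRows 0 1 := by
      ext (i | i) j <;> simp [Matrix.one_apply, apply_ite f, apply_ite L.sec]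
    rw [e1, e2, Matrix.fromCols_mul_fromBlocks, Matrix.fromCols_mul_fromRows]
    simp

theorem apply_mem_ratSubring_of_inverse {n : Type} [Fintype n] [DecidableEq n]
    {P Y : Matrix n n T} (hP : ∀ i j, P i j ∈ ratSubring L f) (augT : T →+* Q)
    (haug : ∀ r, augT (f r) = L.aug r) (h1 : P * Y = 1) (h2 : Y * P = 1) (i j : n) :
    Y i j ∈ ratSubring L f :=
  (IsRatMat.inv (isRatMat_of_apply_mem hP) augT haug h1 h2).apply_mem i j

/-- Normal form `c (1 - B)⁻¹ d` for the elements of `ratSubring`, where the coefficients of `B` are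
linear and have augmentation zero. -/
theorem exists_normal_form {t : T} (ht : t ∈ ratSubring L f) :
    ∃ (p : Type) (_ : Fintype p) (_ : DecidableEq p) (B : Matrix p p R) (X : Matrix p p T)
      (c d : p → Q), (∀ i j, B i j ∈ L.lin) ∧ (∀ i j, L.aug (B i j) = 0) ∧
      (1 - B.map f) * X = 1 ∧ X * (1 - B.map f) = 1 ∧
      t = ∑ i, ∑ j, f (L.sec (c i)) * X i j * f (L.sec (d j)) := by
  obtain ⟨p, _, _, A, X, C, D, hA, ⟨⟨U, W, hUW, hWU⟩, hU⟩, h1, h2, ht⟩ := ht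
  simp only at hU
  have hBf : 1 - (1 - W.map L.sec * A).map f = W.map (f.comp L.sec) * A.map f := by
    have : (W.map L.sec * A).map f = W.map (f.comp L.sec) * A.map f := by
      rw [Matrix.map_mul]; rfl
    rw [← this]
    ext i j
    simp only [Matrix.map_apply, Matrix.sub_apply, map_sub, Matrix.one_apply,
      apply_ite f, map_one, map_zero, sub_sub_cancel]
  have hWU' : W.map (f.comp L.sec) * U.map (f.comp L.sec) = 1 := by
    rw [← Matrix.map_mul, hWU, Matrix.map_one _ (map_zero _) (map_one _)]
  have hUW' : U.map (f.comp L.sec) * W.map (f.comp L.sec) = 1 := by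
    rw [← Matrix.map_mul, hUW, Matrix.map_one _ (map_zero _) (map_one _)]
  -- With U the augmentation of A and W = U⁻¹, take 1 - B = W A. Then (1 - B)⁻¹ = X U, and C X D = C
  -- (X U) (W D).
  refine ⟨p, ‹_›, ‹_›, 1 - W.map L.sec * A, X * U.map (f.comp L.sec), fun i => C () i,
    fun j => (W * D) j (), ?_, ?_, ?_, ?_, ?_⟩
  · intro i j
    refine sub_mem ?_ ?_
    · rw [Matrix.one_apply]
      split_ifs
      · simpa using L.sec_mem 1
      · exact zero_mem _
    · rw [Matrix.mul_apply]
      exact sum_mem fun k _ => L.sec_mul_mem _ _ (hA _ _)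
  · intro i j
    have h : (1 - W.map L.sec * A).map L.aug = 0 := by
      have h' : (W.map L.sec * A).map L.aug = 1 := by
        rw [Matrix.map_mul, L.map_sec_map_aug, ← hU, hWU]
      have : (1 - W.map L.sec * A).map L.aug = 1 - (W.map L.sec * A).map L.aug := by
        ext i j
        simp only [Matrix.map_apply, Matrix.sub_apply, map_sub, Matrix.one_apply,
          apply_ite L.aug, map_one, map_zero]
      rw [this, h', sub_self]
    exact congrFun (congrFun h i) j
  · rw [hBf, Matrix.mul_assoc, ← Matrix.mul_assoc _ X, h1, Matrix.one_mul, hWU']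
  · rw [hBf, Matrix.mul_assoc, ← Matrix.mul_assoc _ _ (A.map f), hUW', Matrix.one_mul, h2]
  · have ht' : t = (C.map (f.comp L.sec) * (X * U.map (f.comp L.sec)) *
        (W * D).map (f.comp L.sec)) () () := by
      rw [Matrix.map_mul, Matrix.mul_assoc, Matrix.mul_assoc X, ← Matrix.mul_assoc _ _ (D.map _),
        hUW', Matrix.one_mul, ← Matrix.mul_assoc, ← ht]
      rfl
    rw [ht', Matrix.mul_apply]
    simp only [Matrix.mul_apply (M := C.map _), Finset.sum_mul]
    rw [Finset.sum_comm]
    rfl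

end AbstractRational

/-! ### Gaussian elimination inside a subring. -/

section Elimination

variable {S Q : Type*} [Ring S] [Ring Q]

/-- The square matrices with coefficients in `T` and augmentation `1` have an inverse with
coefficients in `T`. -/
def InvertsUnipotent (T : Subring S) (aug : S →+* Q) (p : Type*) [Fintype p] [DecidableEq p] :
    Prop :=
  ∀ A : Matrix p p S, (∀ i j, A i j ∈ T) → A.map aug = 1 →
    ∃ B : Matrix p p S, (∀ i j, B i j ∈ T) ∧ A * B = 1 ∧ B * A = 1

theorem matrix_mul_apply_mem {l m n : Type*} [Fintype m] {T : Subring S} {A : Matrix l m S}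
    {B : Matrix m n S} (hA : ∀ i j, A i j ∈ T) (hB : ∀ i j, B i j ∈ T) (i : l) (j : n) :
    (A * B) i j ∈ T := by
  rw [Matrix.mul_apply]
  exact sum_mem fun k _ => mul_mem (hA _ _) (hB _ _)

variable {T : Subring S} {aug : S →+* Q}

theorem InvertsUnipotent.of_equiv {p q : Type*} [Fintype p] [DecidableEq p] [Fintype q]
    [DecidableEq q] (e : p ≃ q) (h : InvertsUnipotent T aug p) : InvertsUnipotent T aug q := by
  intro A hA hA1
  obtain ⟨B, hB, h1, h2⟩ := h (A.submatrix e e) (fun i j => hA _ _) (by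
    rw [← Matrix.submatrix_map, hA1, Matrix.submatrix_one_equiv])
  have hA' : A = (A.submatrix e e).submatrix e.symm e.symm := by simp
  refine ⟨B.submatrix e.symm e.symm, fun i j => hB _ _, ?_, ?_⟩
  · rw [hA', Matrix.submatrix_mul_equiv, h1, Matrix.submatrix_one_equiv]
  · rw [hA', Matrix.submatrix_mul_equiv, h2, Matrix.submatrix_one_equiv]

/-- Since B has augmentation zero, the Schur complement D - C A⁻¹ B still has augmentation 1 and can
be inverted in turn. -/
theorem InvertsUnipotent.sum {p q : Type*} [Fintype p] [DecidableEq p] [Fintype q]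
    [DecidableEq q] (hp : InvertsUnipotent T aug p) (hq : InvertsUnipotent T aug q) :
    InvertsUnipotent T aug (p ⊕ q) := by
  intro M hM hM1
  obtain ⟨A, B, C, D, rfl⟩ : ∃ A B C D, M = Matrix.fromBlocks A B C D :=
    ⟨_, _, _, _, (Matrix.fromBlocks_toBlocks M).symm⟩
  rw [Matrix.fromBlocks_map, ← Matrix.fromBlocks_one, Matrix.fromBlocks_inj] at hM1
  obtain ⟨hA1, hB1, -, hD1⟩ := hM1
  have hA : ∀ i j, A i j ∈ T := fun i j => hM (Sum.inl i) (Sum.inl j)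
  have hB : ∀ i j, B i j ∈ T := fun i j => hM (Sum.inl i) (Sum.inr j)
  have hC : ∀ i j, C i j ∈ T := fun i j => hM (Sum.inr i) (Sum.inl j)
  have hD : ∀ i j, D i j ∈ T := fun i j => hM (Sum.inr i) (Sum.inr j)
  obtain ⟨X, hX, hX1, hX2⟩ := hp A hA hA1
  obtain ⟨W, hW, hW1, hW2⟩ := hq (D - C * X * B)
    (fun i j => sub_mem (hD i j) (matrix_mul_apply_mem (matrix_mul_apply_mem hC hX) hB i j)) (by
      have : (D - C * X * B).map aug = D.map aug - (C * X).map aug * B.map aug := by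
        rw [← Matrix.map_mul]
        ext i j
        simp only [Matrix.map_apply, Matrix.sub_apply, map_sub]
      rw [this, hB1, hD1, Matrix.mul_zero, sub_zero])
  have hXBW := matrix_mul_apply_mem (matrix_mul_apply_mem hX hB) hW
  have hWCX := matrix_mul_apply_mem (matrix_mul_apply_mem hW hC) hX
  refine ⟨Matrix.fromBlocks (X + X * B * (W * C * X)) (-(X * B * W)) (-(W * C * X)) W, ?_, ?_, ?_⟩
  · rintro (i | i) (j | j)
    · exact add_mem (hX i j) (matrix_mul_apply_mem (matrix_mul_apply_mem hX hB) hWCX i j)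
    · exact neg_mem (hXBW i j)
    · exact neg_mem (hWCX i j)
    · exact hW i j
  · have h1 : D * W - C * X * B * W = 1 := by rw [← Matrix.sub_mul, hW1]
    rw [Matrix.fromBlocks_multiply, ← Matrix.fromBlocks_one, Matrix.fromBlocks_inj]
    refine ⟨?_, ?_, ?_, ?_⟩
    · simp only [Matrix.mul_add, ← Matrix.mul_assoc, hX1, Matrix.one_mul, Matrix.mul_neg]
      abel
    · simp only [← Matrix.mul_assoc, hX1, Matrix.one_mul, Matrix.mul_neg]
      abel
    · have h2 : C * (X + X * B * (W * C * X)) + D * -(W * C * X) =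
          C * X - (D * W - C * X * B * W) * (C * X) := by
        simp only [Matrix.mul_add, Matrix.sub_mul, Matrix.mul_assoc, Matrix.mul_neg]
        abel
      rw [h2, h1, Matrix.one_mul, sub_self]
    · rw [← h1]
      simp only [Matrix.mul_assoc, Matrix.mul_neg]
      abel
  · have h1 : W * D - W * C * X * B = 1 := by
      rw [← hW2, Matrix.mul_sub]
      simp only [Matrix.mul_assoc]
    rw [Matrix.fromBlocks_multiply, ← Matrix.fromBlocks_one, Matrix.fromBlocks_inj]
    refine ⟨?_, ?_, ?_, ?_⟩
    · simp only [Matrix.add_mul, Matrix.mul_assoc, hX2, Matrix.mul_one, Matrix.neg_mul]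
      abel
    · have h2 : (X + X * B * (W * C * X)) * B + -(X * B * W) * D =
          X * B - X * B * (W * D - W * C * X * B) := by
        simp only [Matrix.add_mul, Matrix.mul_sub, Matrix.mul_assoc, Matrix.neg_mul]
        abel
      rw [h2, h1, Matrix.mul_one, sub_self]
    · simp only [Matrix.mul_assoc, hX2, Matrix.mul_one, Matrix.neg_mul]
      abel
    · rw [← h1]
      simp only [Matrix.neg_mul]
      abel

/-- Gaussian elimination: if the elements of augmentation `1` of a subring are invertible in it,
then so are the matrices of augmentation `1`. -/
theorem invertsUnipotent_of_forall_mem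
    (hT : ∀ a ∈ T, aug a = 1 → ∃ b ∈ T, a * b = 1 ∧ b * a = 1)
    (p : Type*) [Fintype p] [DecidableEq p] : InvertsUnipotent T aug p := by
  have h1 : InvertsUnipotent T aug (Fin 1) := by
    intro A hA hA1
    obtain ⟨b, hb, hb1, hb2⟩ := hT (A 0 0) (hA 0 0) (by
      simpa using congrFun (congrFun hA1 0) 0)
    refine ⟨Matrix.of fun _ _ => b, fun _ _ => hb, ?_, ?_⟩
    · ext i j
      fin_cases i; fin_cases j
      simpa [Matrix.mul_apply] using hb1
    · ext i j
      fin_cases i; fin_cases j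
      simpa [Matrix.mul_apply] using hb2
  have hfin : ∀ n : ℕ, InvertsUnipotent T aug (Fin n) := by
    intro n
    induction n with
    | zero =>
      exact fun A _ _ => ⟨0, fun i => i.elim0, Subsingleton.elim _ _, Subsingleton.elim _ _⟩
    | succ n ih => exact (ih.sum h1).of_equiv finSumFinEquiv
  exact (hfin _).of_equiv (Fintype.equivFin p).symm

end Elimination

/-! ### Power series: filtration by path length, geometric series, decomposition into paths. -/

section SeriesBasics

variable {V : Type u} [Quiver.{v} V] [Preorder V] {K : PosetOfFields.{u, w} (Comp V)}

namespace PathSeries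

@[simp] theorem sub_apply (a b : PathSeries K) (x y : V) (γ : Quiver.Path x y) :
    (a - b) x y γ = a x y γ - b x y γ := rfl

theorem sum_apply {ι : Type*} (s : Finset ι) (a : ι → PathSeries K) (x y : V)
    (γ : Quiver.Path x y) : (∑ i ∈ s, a i) x y γ = ∑ i ∈ s, a i x y γ :=
  map_sum (⟨⟨fun b : PathSeries K => b x y γ, rfl⟩, fun _ _ => rfl⟩ :
    PathSeries K →+ K.fld (comp y)) a s

/-- The coefficients of `∑_v k_v v`. -/
def diagCoeff (k : ∀ x : V, K.fld (comp x)) : ∀ x y : V, Quiver.Path x y → K.fld (comp y)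
  | _, _, .nil => k _
  | _, _, .cons _ _ => 0

/-- The series `∑_v k_v v`. -/
def diagSeries (k : ∀ x : V, K.fld (comp x)) : PathSeries K := diagCoeff k

@[simp] theorem diagSeries_nil (k : ∀ x : V, K.fld (comp x)) (x : V) :
    diagSeries k x x .nil = k x := rfl

@[simp] theorem diagSeries_cons (k : ∀ x : V, K.fld (comp x)) {x y z : V} (p : Quiver.Path x y)
    (e : y ⟶ z) : diagSeries k x z (p.cons e) = 0 := rfl

/-- The coefficients of `a` vanish at the paths of length less than `n`. -/
def VanishesBelow (n : ℕ) (a : PathSeries K) : Prop :=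
  ∀ (x y : V) (γ : Quiver.Path x y), γ.length < n → a x y γ = 0

theorem vanishesBelow_zero (a : PathSeries K) : VanishesBelow 0 a := fun _ _ _ h => by omega

theorem eq_of_forall_vanishesBelow {a b : PathSeries K} (h : ∀ n, VanishesBelow n (a - b)) :
    a = b := by
  ext x y γ
  exact sub_eq_zero.1 (h (γ.length + 1) x y γ (by omega))

theorem VanishesBelow.sub {n : ℕ} {a b : PathSeries K} (ha : VanishesBelow n a)
    (hb : VanishesBelow n b) : VanishesBelow n (a - b) := by
  intro x y γ hγ
  rw [sub_apply, ha _ _ _ hγ, hb _ _ _ hγ, sub_zero]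

open Classical in
/-- The path `p`, as a series. -/
noncomputable def single (p : Σ x y : V, Quiver.Path x y) : PathSeries K :=
  fun x y γ => if (⟨x, y, γ⟩ : Σ x y : V, Quiver.Path x y) = p then 1 else 0

open Classical in
theorem single_apply (p : Σ x y : V, Quiver.Path x y) (x y : V) (γ : Quiver.Path x y) :
    single (K := K) p x y γ = if (⟨x, y, γ⟩ : Σ x y : V, Quiver.Path x y) = p then 1 else 0 := rfl

theorem single_apply_of_length_ne (p : Σ x y : V, Quiver.Path x y) {x y : V} {γ : Quiver.Path x y}
    (h : γ.length ≠ p.2.2.length) : single (K := K) p x y γ = 0 := by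
  rw [single_apply, if_neg]
  rintro rfl
  exact h rfl

theorem single_nil (x : V) [DecidableEq V] :
    single (K := K) ⟨x, x, .nil⟩ = diagSeries (Pi.single x 1) := by
  ext x' y γ
  cases γ with
  | nil =>
    rw [single_apply, diagSeries_nil]
    by_cases h : x' = x
    · subst h; simp
    · rw [Pi.single_eq_of_ne h, if_neg]
      intro h'
      cases h'
      exact h rfl
  | cons p e =>
    rw [diagSeries_cons, single_apply_of_length_ne]
    simp

variable [PathCompatible V]

theorem diagSeries_mul_apply (k : ∀ x : V, K.fld (comp x)) (a : PathSeries K) (x y : V)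
    (γ : Quiver.Path x y) :
    (diagSeries k * a) x y γ = K.incl (comp_le_of_path γ) (k x) * a x y γ := by
  have h := sum_splits_left γ (fun z α β => K.incl (comp_le_of_path β)
    (diagSeries k x z α) * a z y β)
    (fun z t α e β => by rw [diagSeries_cons, map_zero, zero_mul])
  rw [mul_apply, h, diagSeries_nil]

theorem mul_diagSeries_apply (a : PathSeries K) (k : ∀ x : V, K.fld (comp x)) (x y : V)
    (γ : Quiver.Path x y) : (a * diagSeries k) x y γ = a x y γ * k y := by
  have h := sum_splits_right γ (fun z α β => K.incl (comp_le_of_path β) (a x z α) *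
    diagSeries k z y β) (fun z t α β e => by rw [diagSeries_cons, mul_zero])
  rw [mul_apply, h, diagSeries_nil, K.incl_refl]

/-- If the coefficients of `b` at the paths of length different from `1` are zero, then the
coefficient of `a b` at `γ e` is `a_γ b_e`. -/
theorem mul_apply_cons {b : PathSeries K} (hb : ∀ (x y : V) (γ : Quiver.Path x y),
    γ.length ≠ 1 → b x y γ = 0) (a : PathSeries K) {x y z : V} (p : Quiver.Path x y) (e : y ⟶ z) :
    (a * b) x z (p.cons e) =
      K.incl (comp_le_of_path (Quiver.Path.nil.cons e)) (a x y p) * b y z (.cons .nil e) := by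
  have h := sum_splits_right p (fun t α β => K.incl (comp_le_of_path (β.cons e)) (a x t α) *
    b t z (β.cons e)) (fun t s α β f => by rw [hb _ _ _ (by simp), mul_zero])
  rw [mul_apply]
  simp only [splits, List.map_cons, List.sum_cons, List.map_map, Function.comp_def]
  rw [h, hb _ _ .nil (by simp), mul_zero, zero_add]

theorem mul_apply_nil (a b : PathSeries K) (x : V) :
    (a * b) x x .nil = a x x .nil * b x x .nil := by
  simp [mul_apply, splits, K.incl_refl]

theorem VanishesBelow.mul {m n : ℕ} {a b : PathSeries K} (ha : VanishesBelow m a)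
    (hb : VanishesBelow n b) : VanishesBelow (m + n) (a * b) := by
  intro x y γ hγ
  rw [mul_apply]
  refine List.sum_eq_zero fun c hc => ?_
  obtain ⟨s, hs, rfl⟩ := List.mem_map.1 hc
  have hs := congrArg Quiver.Path.length ((mem_splits γ s).1 hs)
  rw [Quiver.Path.length_comp] at hs
  by_cases h : s.2.1.length < m
  · rw [ha _ _ _ h, map_zero, zero_mul]
  · rw [hb _ _ _ (by omega), mul_zero]

theorem VanishesBelow.pow {a : PathSeries K} (ha : VanishesBelow 1 a) :
    ∀ n : ℕ, VanishesBelow n (a ^ n)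
  | 0 => vanishesBelow_zero _
  | n + 1 => by rw [pow_succ]; exact (ha.pow n).mul ha

theorem vanishesBelow_one_iff {a : PathSeries K} : VanishesBelow 1 a ↔ augmentation K a = 0 := by
  constructor
  · intro h
    funext x
    exact h x x .nil (by simp)
  · intro h x y γ hγ
    cases γ with
    | nil => exact congrFun h x
    | cons p e => simp at hγ

/-- The geometric series `∑ bⁿ`, for `b` of augmentation zero. -/
def geom (b : PathSeries K) : PathSeries K :=
  fun x y γ => (∑ k ∈ Finset.range (γ.length + 1), b ^ k) x y γ

/-- The power b ^ k has no coefficient at paths of length less than k, so at a path of length l only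
the exponents 0, …, l contribute. -/
theorem vanishesBelow_geom_sub {b : PathSeries K} (hb : VanishesBelow 1 b) (n : ℕ) :
    VanishesBelow n (geom b - ∑ k ∈ Finset.range n, b ^ k) := by
  intro x y γ hγ
  rw [sub_apply, sub_eq_zero, geom]
  obtain ⟨m, rfl⟩ := Nat.exists_eq_add_of_le (show γ.length + 1 ≤ n from hγ)
  rw [Finset.sum_range_add _ (γ.length + 1) m, add_apply, sum_apply (Finset.range m),
    Finset.sum_eq_zero (s := Finset.range m), add_zero]
  exact fun k _ => hb.pow _ _ _ _ (by omega)

/-- Replacing the series by its n-th partial sum telescopes; the error vanishes below length n for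
every n. -/
theorem one_sub_mul_geom {b : PathSeries K} (hb : VanishesBelow 1 b) : (1 - b) * geom b = 1 := by
  refine eq_of_forall_vanishesBelow fun n => ?_
  have h : (1 - b) * geom b - 1 =
      (1 - b) * (geom b - ∑ k ∈ Finset.range n, b ^ k) - b ^ n := by
    rw [mul_sub, mul_neg_geom_sum]
    abel
  rw [h]
  have := (vanishesBelow_zero (1 - b)).mul (vanishesBelow_geom_sub hb n)
  rw [zero_add] at this
  exact this.sub (hb.pow n)

theorem geom_mul_one_sub {b : PathSeries K} (hb : VanishesBelow 1 b) : geom b * (1 - b) = 1 := by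
  refine eq_of_forall_vanishesBelow fun n => ?_
  have h : geom b * (1 - b) - 1 =
      (geom b - ∑ k ∈ Finset.range n, b ^ k) * (1 - b) - b ^ n := by
    rw [sub_mul, geom_sum_mul_neg]
    abel
  rw [h]
  exact ((vanishesBelow_geom_sub hb n).mul (vanishesBelow_zero (1 - b))).sub (hb.pow n)

theorem exists_inverse_of_augmentation_eq_one {a : PathSeries K} (ha : augmentation K a = 1) :
    ∃ b, a * b = 1 ∧ b * a = 1 := by
  have h : VanishesBelow 1 (1 - a) := by
    rw [vanishesBelow_one_iff, map_sub, map_one, ha, sub_self]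
  refine ⟨geom (1 - a), ?_, ?_⟩
  · simpa using one_sub_mul_geom h
  · simpa using geom_mul_one_sub h

/-- The geometric series inverts an element of augmentation 1 and division closedness keeps the
inverse in `T`; elimination then passes from elements to matrices. -/
theorem invertsUnipotent_of_isDivisionClosed {T : Subring (PathSeries K)}
    (hT : IsDivisionClosed T) (p : Type*) [Fintype p] [DecidableEq p] :
    InvertsUnipotent T (augmentation K) p := by
  refine invertsUnipotent_of_forall_mem (fun a ha ha1 => ?_) p
  obtain ⟨b, h1, h2⟩ := exists_inverse_of_augmentation_eq_one ha1
  exact ⟨b, hT a ha b h1 h2, h1, h2⟩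

theorem single_cons {x y z : V} (p : Quiver.Path x y) (e : y ⟶ z) :
    single (K := K) ⟨x, z, p.cons e⟩ = single ⟨x, y, p⟩ * single ⟨y, z, .cons .nil e⟩ := by
  classical
  ext x' z' γ
  cases γ with
  | nil =>
    rw [mul_apply_nil, single_apply_of_length_ne, single_apply_of_length_ne (⟨y, z, _⟩ : Sigma _),
      mul_zero]
    · simp
    · simp
  | cons q f =>
    rw [mul_apply_cons (fun _ _ γ hγ => single_apply_of_length_ne _ (by simpa using hγ))]
    simp only [single_apply]
    by_cases h : (⟨x', z', q.cons f⟩ : Σ x y : V, Quiver.Path x y) = ⟨x, z, p.cons e⟩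
    · cases h
      simp
    · rw [if_neg h]
      split_ifs with h1 h2 <;> try simp
      cases h1
      cases h2
      exact h rfl

/-- The coefficient of a path lies in the field of its final vertex, so it has to stand to the right
of the path. -/
theorem eq_sum_single [DecidableEq V] {a : PathSeries K} {s : Finset (Σ x y : V, Quiver.Path x y)}
    (hs : a.support ⊆ s) :
    a = ∑ p ∈ s, single p * diagSeries (Pi.single p.2.1 (a p.1 p.2.1 p.2.2)) := by
  ext x y γ
  simp only [sum_apply, mul_diagSeries_apply, single_apply]
  by_cases h : (⟨x, y, γ⟩ : Σ x y : V, Quiver.Path x y) ∈ s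
  · rw [Finset.sum_eq_single_of_mem _ h]
    · simp
    · intro p _ hp
      rw [if_neg (Ne.symm hp), zero_mul]
  · rw [Finset.sum_eq_zero]
    · by_contra h'
      exact h (hs h')
    · intro p hp
      rw [if_neg, zero_mul]
      rintro rfl
      exact h hp

end PathSeries

end SeriesBasics

theorem path_eq_cons_nil {V : Type u} [Quiver.{v} V] {x y : V} (γ : Quiver.Path x y)
    (h : γ.length = 1) : ∃ e : x ⟶ y, γ = .cons .nil e := by
  cases γ with
  | nil => simp at h
  | cons p e =>
    cases p with
    | nil => exact ⟨e, rfl⟩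
    | cons p f => simp at h

theorem finite_setOf_length_le_one {V : Type u} [Quiver.{v} V] [Finite V]
    [∀ x y : V, Finite (x ⟶ y)] :
    {p : Σ x y : V, Quiver.Path x y | p.2.2.length ≤ 1}.Finite := by
  refine ((Set.finite_range fun x : V => (⟨x, x, .nil⟩ : Σ x y : V, Quiver.Path x y)).union
    (Set.finite_range fun e : (Σ x y : V, x ⟶ y) =>
      (⟨e.1, e.2.1, .cons .nil e.2.2⟩ : Σ x y : V, Quiver.Path x y))).subset ?_
  rintro ⟨x, y, γ⟩ h
  obtain h | h := Nat.le_one_iff_eq_zero_or_eq_one.1 h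
  · cases γ with
    | nil => exact Or.inl ⟨x, rfl⟩
    | cons p e => simp at h
  · obtain ⟨e, rfl⟩ := path_eq_cons_nil γ h
    exact Or.inr ⟨⟨x, y, e⟩, rfl⟩

/-! ### The path algebra and the linear representations of its rational closure. -/

section PathAlgebra

open PathSeries

variable {V : Type u} [Quiver.{v} V] [Finite V] [Preorder V] [PathCompatible V]

theorem mem_pathAlgebra_of_length [∀ x y : V, Finite (x ⟶ y)]
    {K : PosetOfFields.{u, w} (Comp V)} {a : PathSeries K}
    (ha : ∀ (x y : V) (γ : Quiver.Path x y), 1 < γ.length → a x y γ = 0) : a ∈ pathAlgebra K := by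
  refine finite_setOf_length_le_one.subset fun p hp => ?_
  by_contra h
  exact hp (ha _ _ _ (not_le.1 h))

theorem diagSeries_mem_pathAlgebra {K : PosetOfFields.{u, w} (Comp V)}
    (k : ∀ x : V, K.fld (comp x)) : diagSeries k ∈ pathAlgebra K := by
  refine (Set.finite_range fun x : V =>
    (⟨x, x, .nil⟩ : Σ x y : V, Quiver.Path x y)).subset ?_
  rintro ⟨x, y, γ⟩ h
  cases γ with
  | nil => exact ⟨x, rfl⟩
  | cons p e => exact absurd rfl h

theorem single_mem_pathAlgebra {K : PosetOfFields.{u, w} (Comp V)}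
    (p : Σ x y : V, Quiver.Path x y) : single p ∈ pathAlgebra K := by
  refine (Set.finite_singleton p).subset fun q hq => ?_
  by_contra h
  exact hq (if_neg h)

variable (K : PosetOfFields.{u, w} (Comp V))

/-- The embedding `𝓔 → P_K(E)`. -/
def diag : (∀ x : V, K.fld (comp x)) →+* pathAlgebra K where
  toFun k := ⟨diagSeries k, diagSeries_mem_pathAlgebra k⟩
  map_one' := by
    ext x y γ
    cases γ <;> rfl
  map_mul' k l := by
    ext x y γ
    change _ = (diagSeries k * diagSeries l) x y γ
    rw [mul_diagSeries_apply]
    cases γ with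
    | nil => rfl
    | cons p e => simp
  map_zero' := by
    ext x y γ
    cases γ <;> rfl
  map_add' k l := by
    ext x y γ
    cases γ with
    | nil => rfl
    | cons p e =>
      change (0 : K.fld (comp y)) = 0 + 0
      rw [add_zero]

/-- The augmentation of `P_K(E)`, the embedding of `𝓔`, and the elements of `P_K(E)` of degree at
most one. -/
def pathLinearData : LinearData (pathAlgebra K) (∀ x : V, K.fld (comp x)) where
  aug := (augmentation K).comp (pathAlgebra K).subtype
  sec := diag K
  aug_sec _ := rfl
  lin :=
    { carrier := {a | ∀ (x y : V) (γ : Quiver.Path x y), 1 < γ.length → a.1 x y γ = 0}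
      add_mem' := fun {a b} ha hb x y γ h => by
        change a.1 x y γ + b.1 x y γ = 0
        rw [ha x y γ h, hb x y γ h, add_zero]
      zero_mem' := fun _ _ _ _ => rfl
      neg_mem' := fun {a} ha x y γ h => by
        change -a.1 x y γ = 0
        rw [ha x y γ h, neg_zero] }
  sec_mem k x y γ h := by
    cases γ with
    | nil => simp at h
    | cons p e => rfl
  sec_mul_mem k r hr x y γ h := by
    change (diagSeries k * r.1) x y γ = 0
    rw [diagSeries_mul_apply, hr x y γ h, mul_zero]

variable {K}

/-- `P_K(E)` is generated by its elements of degree at most one. -/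
theorem mem_of_lin_le {U : Subring (pathAlgebra K)}
    (hU : ∀ a ∈ (pathLinearData K).lin, a ∈ U) (a : pathAlgebra K) : a ∈ U := by
  classical
  have hdiag (k : ∀ x : V, K.fld (comp x)) :
      diagSeries k ∈ U.map (pathAlgebra K).subtype :=
    ⟨diag K k, hU _ ((pathLinearData K).sec_mem k), rfl⟩
  have hsingle : ∀ (x y : V) (γ : Quiver.Path x y),
      single ⟨x, y, γ⟩ ∈ U.map (pathAlgebra K).subtype := by
    intro x y γ
    induction γ with
    | nil =>
      rw [single_nil]
      exact hdiag _
    | cons p e ih =>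
      rw [single_cons]
      refine mul_mem ih ⟨⟨_, single_mem_pathAlgebra _⟩, hU _ fun _ _ γ h => ?_, rfl⟩
      refine single_apply_of_length_ne _ ?_
      simp only [Quiver.Path.length_cons, Quiver.Path.length_nil]
      omega
  have ha : a.1.support.Finite := a.2
  have h : (a : PathSeries K) ∈ U.map (pathAlgebra K).subtype := by
    rw [eq_sum_single (a := a.1) (s := ha.toFinset) (by simp)]
    exact sum_mem fun p _ => mul_mem (hsingle _ _ _) (hdiag _)
  obtain ⟨b, hb, hba⟩ := h
  rwa [← Subtype.ext hba]

/-- Elements of degree at most one are representable, and they generate the path algebra. -/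
theorem map_mem_ratSubring {T : Type*} [Ring T] (f : pathAlgebra K →+* T) (a : pathAlgebra K) :
    f a ∈ ratSubring (pathLinearData K) f :=
  mem_of_lin_le (U := (ratSubring (pathLinearData K) f).comap f)
    (fun _ h => mem_ratSubring_of_mem_lin h) a

/-- A square matrix over `P_K((E))` is invertible if its augmentation is. -/
theorem isUnit_of_isUnit_augmentation {p : Type*} [Fintype p] [DecidableEq p]
    {A : Matrix p p (PathSeries K)} (hA : IsUnit (A.map (augmentation K))) : IsUnit A := by
  obtain ⟨⟨U, W, hUW, hWU⟩, hU⟩ := hA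
  simp only at hU
  set d : (∀ x : V, K.fld (comp x)) →+* PathSeries K := (pathAlgebra K).subtype.comp (diag K)
  have hd (M : Matrix p p (∀ x : V, K.fld (comp x))) : (M.map d).map (augmentation K) = M := by
    ext; rfl
  have hUW' : U.map d * W.map d = 1 := by
    rw [← Matrix.map_mul, hUW, Matrix.map_one _ (map_zero _) (map_one _)]
  have hWU' : W.map d * U.map d = 1 := by
    rw [← Matrix.map_mul, hWU, Matrix.map_one _ (map_zero _) (map_one _)]
  -- Multiplying by the lifted inverse of the augmentation reduces to augmentation 1; the whole ring
  -- is trivially division closed.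
  obtain ⟨B, -, h1, h2⟩ := invertsUnipotent_of_isDivisionClosed (K := K) (T := ⊤)
    (fun _ _ _ _ _ => trivial) p (W.map d * A) (fun _ _ => trivial) (by
      rw [Matrix.map_mul, hd, ← hU, hWU])
  have hA : A = U.map d * (W.map d * A) := by rw [← Matrix.mul_assoc, hUW', Matrix.one_mul]
  rw [hA]
  exact (isUnit_matrix_of_mul_eq_one hUW' hWU').mul (isUnit_matrix_of_mul_eq_one h1 h2)

/-- The rational closure of `P_K(E)` in `P_K((E))` consists of the series `c A⁻¹ d`. -/
theorem ratSubring_eq_rationalClosure :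
    ratSubring (pathLinearData K) (pathAlgebra K).subtype = rationalClosure (pathAlgebra K) := by
  apply le_antisymm
  · refine le_sInf ?_
    rintro T ⟨hRT, hT⟩ t ⟨p, _, _, A, X, C, D, -, -, h1, h2, ht⟩
    have hX : ∀ i j, X i j ∈ T := by
      let e := Fintype.equivFin p
      have h := hT _ ((A.map (pathAlgebra K).subtype).submatrix e.symm e.symm)
        (X.submatrix e.symm e.symm) (fun i j => hRT (A _ _).2)
        (by rw [Matrix.submatrix_mul_equiv, h1, Matrix.submatrix_one_equiv])
        (by rw [Matrix.submatrix_mul_equiv, h2, Matrix.submatrix_one_equiv])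
      intro i j
      simpa using h (e i) (e j)
    rw [show t = (Matrix.of fun _ _ : Unit => t) () () from rfl, ht]
    exact matrix_mul_apply_mem (matrix_mul_apply_mem (fun i j => hRT (diag K (C i j)).2) hX)
      (fun i j => hRT (diag K (D i j)).2) _ _
  -- The series of the form c A⁻¹ d themselves form a rationally closed subring containing the path
  -- algebra.
  · refine sInf_le ⟨fun a ha => map_mem_ratSubring (pathAlgebra K).subtype ⟨a, ha⟩, ?_⟩
    intro n A B hA h1 h2
    exact apply_mem_ratSubring_of_inverse hA (augmentation K) (fun _ => rfl) h1 h2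

end PathAlgebra

/-! ### The universal property of R Σ⁻¹. -/

namespace UnivLoc

variable {R : Type u} [Ring R] {Sig : ∀ n : ℕ, Set (Matrix (Fin n) (Fin n) R)}

variable (Sig) in
/-- The inverse in `R Σ⁻¹` of a matrix of `Σ`. -/
noncomputable def invMat (n : ℕ) (A : Sig n) : Matrix (Fin n) (Fin n) (UnivLoc R Sig) :=
  Matrix.of fun i j => RingQuot.mkRingHom (LocRel R Sig) (FreeAlgebra.ι ℤ (LocGen.inv n A i j))

theorem map_of_mul_invMat (n : ℕ) (A : Sig n) : A.1.map (of Sig) * invMat Sig n A = 1 := by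
  ext i j
  have h := RingQuot.mkRingHom_rel (LocRel.mul_inv (Sig := Sig) n A i j)
  simp only [map_sum, map_mul, apply_ite (RingQuot.mkRingHom _), map_one, map_zero] at h
  rw [Matrix.mul_apply, Matrix.one_apply]
  exact h

theorem invMat_mul_map_of (n : ℕ) (A : Sig n) : invMat Sig n A * A.1.map (of Sig) = 1 := by
  ext i j
  have h := RingQuot.mkRingHom_rel (LocRel.inv_mul (Sig := Sig) n A i j)
  simp only [map_sum, map_mul, apply_ite (RingQuot.mkRingHom _), map_one, map_zero] at h
  rw [Matrix.mul_apply, Matrix.one_apply]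
  exact h

/-- `R Σ⁻¹` is generated by `R` and the coefficients of the inverses of the matrices of `Σ`. -/
theorem mem_of_generators {U : Subring (UnivLoc R Sig)} (hof : ∀ r, of Sig r ∈ U)
    (hinv : ∀ n A i j, invMat Sig n A i j ∈ U) (t : UnivLoc R Sig) : t ∈ U := by
  obtain ⟨x, rfl⟩ := RingQuot.mkRingHom_surjective _ t
  induction x using FreeAlgebra.induction with
  | grade0 n =>
    rw [eq_intCast, map_intCast]
    exact intCast_mem U n
  | grade1 x =>
    cases x with
    | coeff r => exact hof r
    | inv n A i j => exact hinv n A i j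
  | mul a b ha hb => rw [map_mul]; exact mul_mem ha hb
  | add a b ha hb => rw [map_add]; exact add_mem ha hb

/-- Inverses of matrices are unique, so agreement on `R` forces agreement on the formal inverses. -/
theorem ringHom_ext {T : Type*} [Ring T] {ψ χ : UnivLoc R Sig →+* T}
    (h : ∀ r, ψ (of Sig r) = χ (of Sig r)) : ψ = χ := by
  refine RingHom.ext fun t => ?_
  refine mem_of_generators (U := ψ.eqLocus χ) h (fun n A i j => ?_) t
  have h0 : (A.1.map (of Sig)).map ψ = (A.1.map (of Sig)).map χ := by
    ext i j
    exact h _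
  have h1 : (invMat Sig n A).map ψ * (A.1.map (of Sig)).map ψ = 1 := by
    rw [← Matrix.map_mul, invMat_mul_map_of, Matrix.map_one _ (map_zero _) (map_one _)]
  have h2 : (A.1.map (of Sig)).map χ * (invMat Sig n A).map χ = 1 := by
    rw [← Matrix.map_mul, map_of_mul_invMat, Matrix.map_one _ (map_zero _) (map_one _)]
  have h3 : (invMat Sig n A).map ψ = (invMat Sig n A).map χ :=
    left_inv_eq_right_inv h1 (h0 ▸ h2)
  exact congrFun (congrFun h3 i) j

/-- The formal inverses are sent to the entries of the actual inverses over `T`. -/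
theorem exists_lift {T : Type*} [Ring T] (g : R →+* T)
    (hg : ∀ n, ∀ A ∈ Sig n, IsUnit (A.map g)) :
    ∃ φ : UnivLoc R Sig →+* T, ∀ r, φ (of Sig r) = g r := by
  choose u hu using hg
  let F : LocGen R Sig → T
    | .coeff r => g r
    | .inv n A i j => (↑(u n A.1 A.2)⁻¹ : Matrix (Fin n) (Fin n) T) i j
  refine ⟨RingQuot.lift ⟨(FreeAlgebra.lift ℤ F).toRingHom, ?_⟩, fun r => ?_⟩
  · intro x y hxy
    simp only [AlgHom.toRingHom_eq_coe, RingHom.coe_coe]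
    induction hxy with
    | one => simp [F]
    | add r s => simp [F]
    | mul r s => simp [F]
    | mul_inv n A i j =>
      have h := congrFun (congrFun (u n A.1 A.2).mul_inv i) j
      rw [hu, Matrix.mul_apply, Matrix.one_apply] at h
      simp only [map_sum, map_mul, FreeAlgebra.lift_ι_apply, apply_ite (FreeAlgebra.lift ℤ F),
        map_one, map_zero]
      exact h
    | inv_mul n A i j =>
      have h := congrFun (congrFun (u n A.1 A.2).inv_mul i) j
      rw [hu, Matrix.mul_apply, Matrix.one_apply] at h
      simp only [map_sum, map_mul, FreeAlgebra.lift_ι_apply, apply_ite (FreeAlgebra.lift ℤ F),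
        map_one, map_zero]
      exact h
  · refine (RingQuot.lift_mkRingHom_apply _ _ _).trans ?_
    simp [F]

end UnivLoc

/-! ### Vanishing linear representations and invariant projections. -/

section Injectivity

open PathSeries

variable {V : Type u} [Quiver.{v} V] [Preorder V] [PathCompatible V]
  {K : PosetOfFields.{u, w} (Comp V)}

/-- Over a field the inclusion of U has a linear retraction; row i of E is the image of the i-th
basis vector under it. Matrices act on rows from the right. -/
theorem exists_projection_matrix {F : Type*} [Field F] {p : Type*} [Fintype p] [DecidableEq p]
    (U : Submodule F (p → F)) :
    ∃ E : Matrix p p F, (∀ i, E i ∈ U) ∧ ∀ u ∈ U, Matrix.vecMul u E = u := by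
  obtain ⟨π, hπ⟩ := U.subtype.exists_leftInverse_of_injective U.ker_subtype
  refine ⟨Matrix.of fun i => (π (Pi.single i 1) : p → F), fun i => (π _).2, fun u hu => ?_⟩
  have h : (π u : p → F) = u := congrArg Subtype.val (LinearMap.congr_fun hπ ⟨u, hu⟩)
  conv_rhs => rw [← h]
  rw [pi_eq_sum_univ' u, map_sum]
  simp only [map_smul, Submodule.coe_sum, Submodule.coe_smul]
  ext j
  simp [Matrix.vecMul, dotProduct, Finset.sum_apply, Pi.single_apply]

/-- Let `w = c (1 - B)⁻¹` and `w d = 0`. Projecting onto the spaces spanned by the coefficients of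
`w` gives an idempotent matrix `E` over `𝓔` with `c E = c`, `E B E = E B` and `E d = 0`. -/
theorem exists_invariant_projection {p : Type} [Fintype p] [DecidableEq p]
    {B : Matrix p p (PathSeries K)} (hB : ∀ i j (x y : V) (γ : Quiver.Path x y),
      γ.length ≠ 1 → B i j x y γ = 0) {c d : p → ∀ x : V, K.fld (comp x)} {w : p → PathSeries K}
    (hw : ∀ k, w k = diagSeries (c k) + ∑ j, w j * B j k)
    (hd : ∑ j, w j * diagSeries (d j) = 0) :
    ∃ E : Matrix p p (∀ x : V, K.fld (comp x)), (∀ j, ∑ i, c i * E i j = c j) ∧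
      (∀ i, ∑ j, E i j * d j = 0) ∧
      E.map diagSeries * B * E.map diagSeries = E.map diagSeries * B := by
  -- The span at y of the coefficient rows of w at all paths ending at y.
  let U (y : V) : Submodule (K.fld (comp y)) (p → K.fld (comp y)) :=
    Submodule.span _ (Set.range fun γ : (Σ x : V, Quiver.Path x y) => fun j => w j γ.1 y γ.2)
  have hwU {x y : V} (γ : Quiver.Path x y) : (fun j => w j x y γ) ∈ U y :=
    Submodule.subset_span ⟨⟨x, γ⟩, rfl⟩
  choose P hP hPfix using fun y => exists_projection_matrix (U y)
  -- At a trivial path, w = c + w B reduces to c because B has no coefficients in degree zero.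
  have hcU (y : V) : (fun j => c j y) ∈ U y := by
    have h : (fun j => c j y) = fun j => w j y y .nil := by
      funext k
      rw [hw k, PathSeries.add_apply, PathSeries.sum_apply, Finset.sum_eq_zero, add_zero,
        diagSeries_nil]
      intro j _
      rw [mul_apply_nil, hB _ _ _ _ _ (by simp), mul_zero]
    rw [h]
    exact hwU _
  have hdU (y : V) (u : p → K.fld (comp y)) (hu : u ∈ U y) : ∑ j, u j * d j y = 0 := by
    induction hu using Submodule.span_induction with
    | mem u hu =>
      obtain ⟨⟨x, γ⟩, rfl⟩ := hu
      have h : (∑ j, w j * diagSeries (d j)) x y γ = 0 := by rw [hd, PathSeries.zero_apply]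
      simpa only [PathSeries.sum_apply, mul_diagSeries_apply] using h
    | zero => simp
    | add u u' _ _ hu hu' => simp only [Pi.add_apply, add_mul, Finset.sum_add_distrib, hu, hu',
        add_zero]
    | smul a u _ hu => simp only [Pi.smul_apply, smul_eq_mul, mul_assoc, ← Finset.mul_sum, hu,
        mul_zero]
  -- By w = c + w B, the row of w at γ e is the row at γ, embedded in the field at y, times the
  -- coefficient matrix of B at e. So this semilinear map carries generators of U x to generators of
  -- U y.
  have hBU {x y : V} (e : x ⟶ y) (u : p → K.fld (comp x)) (hu : u ∈ U x) :
      (fun k => ∑ j, K.incl (comp_le_of_path (Quiver.Path.nil.cons e)) (u j) *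
        B j k x y (.cons .nil e)) ∈ U y := by
    induction hu using Submodule.span_induction with
    | mem u hu =>
      obtain ⟨⟨z, γ⟩, rfl⟩ := hu
      have h : (fun k => ∑ j, K.incl (comp_le_of_path (Quiver.Path.nil.cons e)) (w j z x γ) *
        B j k x y (.cons .nil e)) = fun k => w k z y (γ.cons e) := by
        funext k
        conv_rhs => rw [hw k]
        rw [PathSeries.add_apply, diagSeries_cons, zero_add, PathSeries.sum_apply]
        exact Finset.sum_congr rfl fun j _ => (mul_apply_cons (hB j k) _ _ _).symm
      exact h ▸ hwU _
    | zero => convert (U y).zero_mem using 1; funext k; simp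
    | add u u' _ _ hu hu' =>
      convert (U y).add_mem hu hu' using 1
      funext k
      simp only [Pi.add_apply, map_add, add_mul, Finset.sum_add_distrib]
    | smul a u _ hu =>
      convert (U y).smul_mem (K.incl (comp_le_of_path (Quiver.Path.nil.cons e)) a) hu using 1
      funext k
      simp only [Pi.smul_apply, smul_eq_mul, map_mul, mul_assoc, ← Finset.mul_sum]
  refine ⟨Matrix.of fun i j y => P y i j, fun j => ?_, fun i => ?_, ?_⟩
  · funext y
    rw [Finset.sum_apply]
    exact congrFun (hPfix y _ (hcU y)) j
  · funext y
    rw [Finset.sum_apply]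
    exact hdU y _ (hP y i)
  · ext i k x y γ
    rw [Matrix.mul_apply, PathSeries.sum_apply]
    simp only [Matrix.map_apply, mul_diagSeries_apply]
    simp only [Matrix.mul_apply, PathSeries.sum_apply, Matrix.map_apply, diagSeries_mul_apply]
    by_cases hγ : γ.length = 1
    · obtain ⟨e, rfl⟩ := path_eq_cons_nil γ hγ
      -- The rows of E at x lie in U x, the arrow carries them into U y, and there E acts as the
      -- identity.
      exact congrFun (hPfix y _ (hBU e _ (hP x i))) k
    · simp [hB _ _ _ _ _ hγ]

/-- The projection E is found by looking at series, but its identities hold over the path algebra,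
so they can be transported along `f` to `T`. There E intertwines 1 - B with 1 - E B, which is also
invertible over `T`. -/
theorem eq_zero_of_map_eq_zero [Finite V] {T : Type*} [Ring T] {f : pathAlgebra K →+* T}
    (hf : ∀ (p : Type) [Fintype p] [DecidableEq p] (B : Matrix p p (pathAlgebra K)),
      (∀ i j, (pathLinearData K).aug (B i j) = 0) → IsUnit (1 - B.map f))
    {φ : T →+* PathSeries K} (hφ : ∀ r, φ (f r) = r) {t : T}
    (ht : t ∈ ratSubring (pathLinearData K) f) (h0 : φ t = 0) : t = 0 := by
  obtain ⟨p, _, _, B, X, c, d, hB, hB0, h1, h2, rfl⟩ := exists_normal_form ht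
  -- Degree at most one together with augmentation zero means homogeneous of degree one.
  have hBlen : ∀ i j (x y : V) (γ : Quiver.Path x y), γ.length ≠ 1 →
      B.map Subtype.val i j x y γ = 0 := by
    intro i j x y γ hγ
    by_cases h : 1 < γ.length
    · exact hB i j x y γ h
    · exact vanishesBelow_one_iff.2 (hB0 i j) x y γ (by omega)
  have hBφ : (B.map f).map φ = B.map Subtype.val := by
    ext i j
    simp [hφ]
  have hX : X.map φ * (1 - B.map Subtype.val) = 1 := by
    have := congrArg φ.mapMatrix h2
    rwa [map_mul, map_sub, map_one, RingHom.mapMatrix_apply, RingHom.mapMatrix_apply, hBφ] at this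
  have hX' : X.map φ = 1 + X.map φ * B.map Subtype.val := by
    rw [Matrix.mul_sub, Matrix.mul_one] at hX
    rw [← hX, sub_add_cancel]
  obtain ⟨E, hcE, hEd, hEB⟩ := exists_invariant_projection (B := B.map Subtype.val) hBlen
    (c := c) (d := d) (w := fun j => ∑ i, diagSeries (c i) * φ (X i j)) (by
      intro k
      have h (i : p) : φ (X i k) = (1 : Matrix p p (PathSeries K)) i k +
          ∑ j, φ (X i j) * (B j k).1 := by
        have := congrFun (congrFun hX' i) k
        rwa [Matrix.add_apply, Matrix.mul_apply] at this
      simp only [Finset.sum_mul]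
      rw [Finset.sum_comm]
      conv_lhs => simp only [h, mul_add, Finset.sum_add_distrib, Finset.mul_sum, ← mul_assoc]
      congr 1
      simp [Matrix.one_apply]) (by
      rw [← h0]
      simp only [map_sum, map_mul, hφ, Finset.sum_mul]
      rw [Finset.sum_comm]
      rfl)
  have hEB' : E.map (diag K) * B * E.map (diag K) = E.map (diag K) * B := by
    have hinj : Function.Injective fun M : Matrix p p (pathAlgebra K) =>
        (pathAlgebra K).subtype.mapMatrix M :=
      Matrix.map_injective Subtype.val_injective
    apply hinj
    simp only [map_mul]
    exact hEB
  -- E B has augmentation zero along with B, so 1 - E B acquires an inverse Y over `T`.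
  obtain ⟨⟨M, Y, _, hY⟩, hM⟩ := hf p (E.map (diag K) * B) (by
    intro i j
    rw [Matrix.mul_apply, map_sum]
    exact Finset.sum_eq_zero fun k _ => by rw [map_mul, hB0, mul_zero])
  simp only at hM
  set g : (∀ x : V, K.fld (comp x)) →+* T := f.comp (diag K)
  -- From E (1 - B) = (1 - E B) E, which is E B E = E B rearranged; E then moves across the inverse
  -- until it meets d.
  have hcomm : Y * E.map g = E.map g * X := by
    have e1 : (E.map (diag K)).map f = E.map g := rfl
    have e2 : E.map g * (1 - B.map f) = M * E.map g := by
      have h := congrArg (fun M : Matrix p p (pathAlgebra K) => M.map f) hEB'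
      simp only [Matrix.map_mul, e1] at h
      rw [hM, Matrix.map_mul, e1, Matrix.mul_sub, Matrix.sub_mul, h, Matrix.mul_one, Matrix.one_mul]
    calc Y * E.map g = Y * (E.map g * (1 - B.map f)) * X := by
          rw [Matrix.mul_assoc, Matrix.mul_assoc, h1, Matrix.mul_one]
      _ = E.map g * X := by rw [e2, ← Matrix.mul_assoc, hY, Matrix.one_mul]
  have hsum : ∑ i, ∑ j, f ((pathLinearData K).sec (c i)) * X i j * f ((pathLinearData K).sec (d j))
      = dotProduct (Matrix.vecMul (fun i => g (c i)) X) (fun j => g (d j)) := by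
    simp only [dotProduct, Matrix.vecMul, Finset.sum_mul]
    rw [Finset.sum_comm]
    rfl
  have hc : Matrix.vecMul (fun i => g (c i)) (E.map g) = fun i => g (c i) := by
    funext j
    simp only [Matrix.vecMul, dotProduct, Matrix.map_apply, ← map_mul, ← map_sum, hcE]
  have hdz : Matrix.mulVec (E.map g) (fun j => g (d j)) = 0 := by
    funext i
    simp only [Matrix.mulVec, dotProduct, Matrix.map_apply, ← map_mul, ← map_sum, hEd, map_zero,
      Pi.zero_apply]
  rw [hsum, ← hc, Matrix.vecMul_vecMul, ← hcomm, ← Matrix.vecMul_vecMul, ← Matrix.dotProduct_mulVec,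
    hdz, dotProduct_zero]

end Injectivity

/-! ### The universal localization is the rational closure. -/

section Localization

open PathSeries

variable {V : Type u} [Quiver.{v} V] [Finite V] [Preorder V] [PathCompatible V]
  (K : PosetOfFields.{u, w} (Comp V))

theorem exists_univLoc_toSeries : ∃ φ : UnivLoc (pathAlgebra K) (sigmaSet K) →+* PathSeries K,
    ∀ r : pathAlgebra K, φ (UnivLoc.of (sigmaSet K) r) = r :=
  UnivLoc.exists_lift (pathAlgebra K).subtype fun _ A hA =>
    isUnit_of_isUnit_augmentation (A := A.map (pathAlgebra K).subtype) hA

theorem isUnit_map_of {p : Type*} [Fintype p] [DecidableEq p] {A : Matrix p p (pathAlgebra K)}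
    (hA : IsUnit (A.map (pathLinearData K).aug)) : IsUnit (A.map (UnivLoc.of (sigmaSet K))) := by
  let e := Fintype.equivFin p
  have h : A.submatrix e.symm e.symm ∈ sigmaSet K (Fintype.card p) :=
    hA.map (Matrix.reindexRingEquiv _ e)
  have hu := isUnit_matrix_of_mul_eq_one (UnivLoc.map_of_mul_invMat _ ⟨_, h⟩)
    (UnivLoc.invMat_mul_map_of _ ⟨_, h⟩)
  have := hu.map (Matrix.reindexRingEquiv _ e.symm)
  convert this using 1
  ext i j
  simp [e]

/-- The map to power series followed by ε is an augmentation on the localization, so the inversion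
lemma for representations applies to the formal inverses. -/
theorem mem_ratSubring_univLoc (t : UnivLoc (pathAlgebra K) (sigmaSet K)) :
    t ∈ ratSubring (pathLinearData K) (UnivLoc.of (sigmaSet K)) := by
  obtain ⟨φ, hφ⟩ := exists_univLoc_toSeries K
  refine UnivLoc.mem_of_generators (map_mem_ratSubring _) (fun n A i j => ?_) t
  exact apply_mem_ratSubring_of_inverse (P := A.1.map (UnivLoc.of (sigmaSet K)))
    (fun i j => map_mem_ratSubring _ _) ((augmentation K).comp φ)
    (fun r => by rw [RingHom.comp_apply, hφ]; rfl) (UnivLoc.map_of_mul_invMat n A)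
    (UnivLoc.invMat_mul_map_of n A) i j

/-- The universal localization of `P_K(E)` at `Σ` is the rational closure of `P_K(E)` in
`P_K((E))`. -/
theorem exists_univLoc_bijective :
    ∃ φ : UnivLoc (pathAlgebra K) (sigmaSet K) →+* rationalClosure (pathAlgebra K),
      (∀ r : pathAlgebra K, (φ (UnivLoc.of (sigmaSet K) r) : PathSeries K) = r) ∧
      (∀ ψ : UnivLoc (pathAlgebra K) (sigmaSet K) →+* rationalClosure (pathAlgebra K),
        (∀ r : pathAlgebra K, (ψ (UnivLoc.of (sigmaSet K) r) : PathSeries K) = r) → ψ = φ) ∧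
      Function.Bijective φ := by
  obtain ⟨φ, hφ⟩ := exists_univLoc_toSeries K
  have hmat {p : Type} [Fintype p] (A : Matrix p p (pathAlgebra K)) :
      (A.map (UnivLoc.of (sigmaSet K))).map φ = A.map (pathAlgebra K).subtype := by
    ext i j
    simp [hφ]
  have hrange (t) : φ t ∈ rationalClosure (pathAlgebra K) := by
    rw [← ratSubring_eq_rationalClosure]
    refine UnivLoc.mem_of_generators (U := (ratSubring _ _).comap φ) (fun r => ?_)
      (fun n A i j => ?_) t
    · rw [Subring.mem_comap, hφ]
      exact map_mem_ratSubring (pathAlgebra K).subtype r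
    · refine apply_mem_ratSubring_of_inverse (P := A.1.map (pathAlgebra K).subtype)
        (Y := (UnivLoc.invMat _ n A).map φ) (fun i j => map_mem_ratSubring _ _) (augmentation K)
        (fun _ => rfl) ?_ ?_ i j
      · rw [← hmat, ← Matrix.map_mul, UnivLoc.map_of_mul_invMat,
          Matrix.map_one _ (map_zero _) (map_one _)]
      · rw [← hmat, ← Matrix.map_mul, UnivLoc.invMat_mul_map_of,
          Matrix.map_one _ (map_zero _) (map_one _)]
  refine ⟨φ.codRestrict _ hrange, hφ, fun ψ hψ => ?_, ?_, ?_⟩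
  · exact UnivLoc.ringHom_ext fun r => Subtype.ext ((hψ r).trans (hφ r).symm)
  · rw [injective_iff_map_eq_zero]
    intro t ht
    refine eq_zero_of_map_eq_zero (fun p _ _ B hB => ?_) hφ (mem_ratSubring_univLoc K t)
      (congrArg Subtype.val ht)
    have h1 : (1 - B).map (pathLinearData K).aug = 1 := by
      ext i j : 2
      rw [Matrix.map_apply, Matrix.sub_apply, map_sub, hB, sub_zero, Matrix.one_apply,
        Matrix.one_apply, apply_ite (pathLinearData K).aug, map_one, map_zero]
    have h2 : (1 - B).map (UnivLoc.of (sigmaSet K)) = 1 - B.map (UnivLoc.of (sigmaSet K)) := by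
      ext i j
      rw [Matrix.map_apply, Matrix.sub_apply, map_sub, Matrix.sub_apply, Matrix.one_apply,
        Matrix.one_apply, apply_ite (UnivLoc.of (sigmaSet K)), map_one, map_zero, Matrix.map_apply]
    rw [← h2]
    exact isUnit_map_of K (h1 ▸ isUnit_one)
  -- Surjectivity: the matrix A in s = c A⁻¹ d is already invertible over the localization, and by
  -- uniqueness its inverse there maps to the inverse over series.
  · rintro ⟨s, hs⟩
    rw [← ratSubring_eq_rationalClosure] at hs
    obtain ⟨p, _, _, A, X, C, D, -, hA, h1, h2, hs⟩ := hs
    obtain ⟨⟨M, Y, hMY, _⟩, hM⟩ := isUnit_map_of K hA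
    simp only at hM
    have hY : Y.map φ = X := by
      have h3 : A.map (pathAlgebra K).subtype * Y.map φ = 1 := by
        rw [← hmat, ← Matrix.map_mul, ← hM, hMY, Matrix.map_one _ (map_zero _) (map_one _)]
      exact (left_inv_eq_right_inv h2 h3).symm
    refine ⟨(C.map ((UnivLoc.of (sigmaSet K)).comp (diag K)) * Y *
      D.map ((UnivLoc.of (sigmaSet K)).comp (diag K))) () (), Subtype.ext ?_⟩
    have hφd {m n : Type} (N : Matrix m n (∀ x : V, K.fld (comp x))) :
        (N.map ((UnivLoc.of (sigmaSet K)).comp (diag K))).map φ =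
          N.map ((pathAlgebra K).subtype.comp (pathLinearData K).sec) := by
      ext i j
      simp [hφ, pathLinearData]
    change φ _ = s
    rw [← Matrix.map_apply (f := φ), Matrix.map_mul, Matrix.map_mul, hφd, hφd, hY, ← hs]
    rfl

end Localization

/-! ### Closure operators and the idempotents of sets of components. -/

theorem le_divisionClosure {S : Type u} [Ring S] (R : Subring S) : R ≤ divisionClosure R :=
  le_sInf fun _ h => h.1

theorem isDivisionClosed_divisionClosure {S : Type u} [Ring S] (R : Subring S) :
    IsDivisionClosed (divisionClosure R) := by
  intro x hx y h1 h2
  rw [divisionClosure, Subring.mem_sInf] at hx ⊢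
  exact fun T hT => hT.2 x (hx T hT) y h1 h2

theorem le_rationalClosure {S : Type u} [Ring S] (R : Subring S) : R ≤ rationalClosure R :=
  le_sInf fun _ h => h.1

theorem isDivisionClosed_rationalClosure {S : Type u} [Ring S] (R : Subring S) :
    IsDivisionClosed (rationalClosure R) := by
  intro x hx y h1 h2
  rw [rationalClosure, Subring.mem_sInf] at hx ⊢
  intro T hT
  refine hT.2 1 (Matrix.of fun _ _ => x) (Matrix.of fun _ _ => y) (fun _ _ => hx T hT) ?_ ?_ 0 0
  · ext i j
    fin_cases i; fin_cases j
    simpa [Matrix.mul_apply] using h1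
  · ext i j
    fin_cases i; fin_cases j
    simpa [Matrix.mul_apply] using h2

theorem finite_comp {V : Type u} [Preorder V] [Finite V] : Finite (Comp V) :=
  Finite.of_surjective (comp (V := V)) fun i => ⟨ofAntisymmetrization _ i,
    toAntisymmetrization_ofAntisymmetrization _ i⟩

section Idem

variable {V : Type u} [Preorder V]

open Classical in
/-- The idempotent `∑ v`, for the vertices `v` whose component lies in `J`. -/
noncomputable def idem (K : PosetOfFields.{u, w} (Comp V)) (J : Set (Comp V)) :
    ∀ x : V, K.fld (comp x) :=
  fun x => if comp x ∈ J then 1 else 0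

variable {K : PosetOfFields.{u, w} (Comp V)} {J : Set (Comp V)}

theorem idem_of_mem {x : V} (h : comp x ∈ J) : idem K J x = 1 := if_pos h

theorem idem_of_notMem {x : V} (h : comp x ∉ J) : idem K J x = 0 := if_neg h

theorem idem_mul_idem : idem K J * idem K J = idem K J := by
  funext x
  rw [Pi.mul_apply, idem]
  split_ifs <;> simp

end Idem

theorem Below.length_path {V : Type u} [Quiver.{v} V] [Preorder V] {i : Comp V} {x y : Below i}
    (γ : Quiver.Path x y) : (Below.path γ).length = γ.length := by
  induction γ with
  | nil => rfl
  | cons p e ih =>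
    change (Below.path p).length + 1 = p.length + 1
    rw [ih]

/-! ### Passage between series over E and series over E_{I↓i}. -/

section Restr

variable {V : Type u} [Quiver.{v} V] [Preorder V] (K : PosetOfFields.{u, w} (Comp V)) {i : Comp V}

open Classical in
variable (i) in
/-- The part of a series supported on the paths in the component `i`, as a series in the paths of
`E_{I↓i}` with coefficients in `K_i`. -/
noncomputable def restr (a : PathSeries K) : FieldSeries (Below i) (K.fld i) :=
  fun x y γ => if h : i ≤ comp y.val then K.incl h (a x.val y.val (Below.path γ)) else
    (0 : K.fld i)

theorem restr_apply_of_le (a : PathSeries K) {x y : Below i} (γ : Quiver.Path x y)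
    (h : i ≤ comp y.val) : restr K i a x y γ = K.incl h (a x.val y.val (Below.path γ)) :=
  dif_pos h

theorem restr_apply_of_not_le (a : PathSeries K) {x y : Below i} (γ : Quiver.Path x y)
    (h : ¬ i ≤ comp y.val) : restr K i a x y γ = (0 : K.fld i) :=
  dif_neg h

theorem restr_apply_eq_zero {a : PathSeries K} {x y : Below i} {γ : Quiver.Path x y}
    (h : a x.val y.val (Below.path γ) = 0) : restr K i a x y γ = (0 : K.fld i) := by
  by_cases hy : i ≤ comp y.val
  · exact (restr_apply_of_le K a γ hy).trans ((congrArg _ h).trans (map_zero _))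
  · exact restr_apply_of_not_le K a γ hy

end Restr

section Extension

variable {V : Type u} [Quiver.{v} V] [Preorder V] [PathCompatible V]

theorem Below.path_lift {i : Comp V} {x : V} (hx : comp x ≤ i) {y : V} (γ : Quiver.Path x y) :
    Below.path (Below.lift hx γ) = γ := by
  induction γ with
  | nil => rfl
  | cons p e ih =>
    change Quiver.Path.cons (Below.path (Below.lift hx p)) e = p.cons e
    rw [ih]

/-- A path that starts in E_{I↓i} never leaves it, so both graphs give it the same factorizations.
This makes `extend` multiplicative. -/
theorem Below.splits_lift {i : Comp V} {x : V} (hx : comp x ≤ i) {y : V} (γ : Quiver.Path x y) :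
    splits (Below.lift hx γ) = (splits γ).map fun s =>
      ⟨⟨s.1, (comp_le_of_path s.2.1).trans hx⟩, Below.lift hx s.2.1,
        Below.lift ((comp_le_of_path s.2.1).trans hx) s.2.2⟩ := by
  induction γ with
  | nil => rfl
  | cons p e ih =>
    simp only [Below.lift, splits, ih, List.map_cons, List.map_map]
    rfl

variable (K : PosetOfFields.{u, w} (Comp V)) {i : Comp V}

theorem extend_apply_of_le (a : FieldSeries (Below i) (K.fld i)) {x y : V} (hx : comp x ≤ i)
    (γ : Quiver.Path x y) : extend K i a x y γ = K.incl ((comp_le_of_path γ).trans hx)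
      (show K.fld i from a ⟨x, hx⟩ ⟨y, (comp_le_of_path γ).trans hx⟩ (Below.lift hx γ)) :=
  dif_pos hx

theorem extend_apply_of_not_le (a : FieldSeries (Below i) (K.fld i)) {x y : V}
    (hx : ¬ comp x ≤ i) (γ : Quiver.Path x y) : extend K i a x y γ = 0 :=
  dif_neg hx

theorem extend_mul (a b : FieldSeries (Below i) (K.fld i)) :
    extend K i (a * b) = extend K i a * extend K i b := by
  ext x y γ
  by_cases hx : comp x ≤ i
  · rw [extend_apply_of_le K _ hx, PathSeries.mul_apply, PathSeries.mul_apply, Below.splits_lift,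
      List.map_map]
    refine (map_list_sum (K.incl ((comp_le_of_path γ).trans hx)) _).trans ?_
    refine (congrArg List.sum List.map_map).trans ?_
    refine congrArg List.sum (List.map_congr_left fun s _ => ?_)
    rw [extend_apply_of_le K _ hx, extend_apply_of_le K _ ((comp_le_of_path s.2.1).trans hx),
      K.incl_trans]
    exact map_mul (K.incl ((comp_le_of_path γ).trans hx)) _ _
  · rw [extend_apply_of_not_le K _ hx, PathSeries.mul_apply, List.sum_eq_zero]
    intro c hc
    obtain ⟨s, -, rfl⟩ := List.mem_map.1 hc
    rw [extend_apply_of_not_le K _ hx, map_zero, zero_mul]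

theorem extend_one : extend K i 1 = PathSeries.diagSeries (idem K (Set.Iic i)) := by
  ext x y γ
  by_cases hx : comp x ≤ i
  · rw [extend_apply_of_le K _ hx]
    cases γ with
    | nil =>
      rw [PathSeries.diagSeries_nil, idem_of_mem (Set.mem_Iic.2 hx)]
      exact map_one (K.incl hx)
    | cons p e => exact map_zero (K.incl _)
  · rw [extend_apply_of_not_le K _ hx]
    cases γ with
    | nil => rw [PathSeries.diagSeries_nil, idem_of_notMem (fun h => hx (Set.mem_Iic.1 h))]
    | cons p e => rfl

/-- A path that starts below i and ends in the component i lies wholly in that component, since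
components decrease along paths. There the field is K_i itself, so no coefficient is changed. -/
theorem extend_restr (a : PathSeries K) : extend K i (restr K i a) =
    PathSeries.diagSeries (idem K {i}) * a * PathSeries.diagSeries (idem K {i}) := by
  ext x y γ
  rw [PathSeries.mul_diagSeries_apply, PathSeries.diagSeries_mul_apply]
  have hyx := comp_le_of_path γ
  by_cases hy : comp y = i
  · by_cases hx : comp x = i
    · rw [extend_apply_of_le K _ hx.le, idem_of_mem hx, idem_of_mem hy, map_one, one_mul, mul_one]
      have h := restr_apply_of_le K a (Below.lift hx.le γ) hy.ge
      rw [Below.path_lift hx.le γ] at h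
      refine (congrArg _ h).trans ?_
      rw [K.incl_trans, K.incl_refl]
    · have hx' : ¬ comp x ≤ i := fun h => hx (le_antisymm h (hy ▸ hyx))
      rw [extend_apply_of_not_le K _ hx', idem_of_notMem hx, map_zero, zero_mul, zero_mul]
  · rw [idem_of_notMem (x := y) hy, mul_zero]
    by_cases hx : comp x ≤ i
    · rw [extend_apply_of_le K _ hx]
      have h := restr_apply_of_not_le K a (Below.lift hx γ)
        fun h => hy (le_antisymm (hyx.trans hx) h)
      exact (congrArg _ h).trans (map_zero _)
    · exact extend_apply_of_not_le K _ hx _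

theorem extend_single {x y : V} (hx : comp x ≤ i) (γ : Quiver.Path x y) :
    extend K i (PathSeries.single ⟨⟨x, hx⟩, ⟨y, (comp_le_of_path γ).trans hx⟩, Below.lift hx γ⟩) =
      PathSeries.single ⟨x, y, γ⟩ := by
  ext x' y' γ'
  by_cases hx' : comp x' ≤ i
  · rw [extend_apply_of_le K _ hx']
    by_cases h : (⟨x', y', γ'⟩ : Σ x y : V, Quiver.Path x y) = ⟨x, y, γ⟩
    · cases h
      rw [PathSeries.single_apply, PathSeries.single_apply, if_pos rfl, if_pos rfl]
      exact map_one (K.incl _)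
    · rw [PathSeries.single_apply, PathSeries.single_apply, if_neg h, if_neg]
      · exact map_zero (K.incl _)
      · intro h'
        have := congrArg (fun p : (Σ x y : Below i, Quiver.Path x y) =>
          (⟨p.1.val, p.2.1.val, Below.path p.2.2⟩ : Σ x y : V, Quiver.Path x y)) h'
        simp only [Below.path_lift] at this
        exact h this
  · rw [extend_apply_of_not_le K _ hx', PathSeries.single_apply, if_neg]
    intro h
    cases h
    exact hx' hx

variable {K} in
theorem sum_idem_mul [Fintype (Comp V)] (a : PathSeries K) :
    ∑ i : Comp V, PathSeries.diagSeries (idem K {i}) * a = a := by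
  ext x y γ
  simp only [PathSeries.sum_apply, PathSeries.diagSeries_mul_apply]
  rw [Finset.sum_eq_single_of_mem (comp x) (Finset.mem_univ _),
    idem_of_mem (Set.mem_singleton _), map_one, one_mul]
  intro i _ hi
  rw [idem_of_notMem (fun h => hi h.symm), map_zero, zero_mul]

end Extension

/-! ### The groups P^rat_J as rational series with prescribed sources. -/

section RationalSeries

open PathSeries

variable {V : Type u} [Quiver.{v} V] [Finite V] [Preorder V] [PathCompatible V]
  (K : PosetOfFields.{u, w} (Comp V))

theorem mul_mem_ratAt {i : Comp V} {a b : PathSeries K} (ha : a ∈ ratAt K i)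
    (hb : b ∈ ratAt K i) : a * b ∈ ratAt K i := by
  obtain ⟨a, ha, rfl⟩ := ha
  obtain ⟨b, hb, rfl⟩ := hb
  exact ⟨a * b, (fieldRat (Below i) (K.fld i)).mul_mem ha hb, extend_mul K a b⟩

theorem extend_mem_ratAt {i : Comp V} {a : FieldSeries (Below i) (K.fld i)}
    (ha : a ∈ fieldRat (Below i) (K.fld i)) : extend K i a ∈ ratAt K i := ⟨a, ha, rfl⟩

theorem single_mem_ratAt {i : Comp V} {p : Σ x y : V, Quiver.Path x y} (hp : comp p.1 ≤ i) :
    single p ∈ ratAt K i := by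
  obtain ⟨x, y, γ⟩ := p
  rw [← extend_single K hp γ]
  exact extend_mem_ratAt K (le_divisionClosure _ (single_mem_pathAlgebra _))

/-- The elements of the rational closure of `P_K(E)` supported on the paths whose source has its
component in `J`. -/
def ratOn (J : Set (Comp V)) : AddSubgroup (PathSeries K) where
  carrier := {a | a ∈ rationalClosure (pathAlgebra K) ∧
    ∀ (x y : V) (γ : Quiver.Path x y), comp x ∉ J → a x y γ = 0}
  add_mem' := fun {a b} ha hb => ⟨add_mem ha.1 hb.1, fun x y γ h => by
    rw [PathSeries.add_apply, ha.2 x y γ h, hb.2 x y γ h, add_zero]⟩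
  zero_mem' := ⟨zero_mem _, fun _ _ _ _ => rfl⟩
  neg_mem' := fun {a} ha => ⟨neg_mem ha.1, fun x y γ h => by
    rw [PathSeries.neg_apply, ha.2 x y γ h, neg_zero]⟩

variable {K}

theorem ratOn_mono {J J' : Set (Comp V)} (h : J ⊆ J') : ratOn K J ≤ ratOn K J' :=
  fun _ ha => ⟨ha.1, fun x y γ hx => ha.2 x y γ fun hx' => hx (h hx')⟩

theorem ratOn_univ : ratOn K Set.univ = (rationalClosure (pathAlgebra K)).toAddSubgroup := by
  ext a
  exact ⟨fun h => h.1, fun h => ⟨h, fun _ _ _ hx => absurd trivial hx⟩⟩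

theorem mul_mem_ratOn {J : Set (Comp V)} {a b : PathSeries K} (ha : a ∈ ratOn K J)
    (hb : b ∈ rationalClosure (pathAlgebra K)) : a * b ∈ ratOn K J := by
  refine ⟨mul_mem ha.1 hb, fun x y γ hx => ?_⟩
  rw [PathSeries.mul_apply, List.sum_eq_zero]
  intro c hc
  obtain ⟨s, -, rfl⟩ := List.mem_map.1 hc
  rw [ha.2 _ _ _ hx, map_zero, zero_mul]

theorem diagSeries_mem_rationalClosure (k : ∀ x : V, K.fld (comp x)) :
    diagSeries k ∈ rationalClosure (pathAlgebra K) :=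
  le_rationalClosure _ (diagSeries_mem_pathAlgebra k)

/-- The series over E_{I↓i} whose extension is rational over E form a division closed subring
containing the path algebra of E_{I↓i}. -/
theorem ratAt_le_ratOn (i : Comp V) : ratAt K i ≤ ratOn K (Set.Iic i) := by
  rintro _ ⟨a, ha, rfl⟩
  refine ⟨?_, fun x y γ hx => extend_apply_of_not_le K a hx γ⟩
  let T : Subring (FieldSeries (Below i) (K.fld i)) :=
    { (rationalClosure (pathAlgebra K)).toAddSubgroup.comap (extend K i) with
      mul_mem' := fun {a b} ha hb => by
        change extend K i (a * b) ∈ rationalClosure (pathAlgebra K)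
        rw [extend_mul]
        exact mul_mem (S := Subring _) ha hb
      one_mem' := by
        change extend K i 1 ∈ rationalClosure (pathAlgebra K)
        rw [extend_one]
        exact diagSeries_mem_rationalClosure _ }
  have hT (b) : b ∈ T ↔ extend K i b ∈ rationalClosure (pathAlgebra K) := Iff.rfl
  refine (sInf_le (a := T) ⟨fun b hb => ?_, fun b hb c h1 h2 => ?_⟩ :
    fieldRat (Below i) (K.fld i) ≤ T) ha
  · refine le_rationalClosure _ (Set.Finite.subset (Set.Finite.image
      (fun p : (Σ x y : Below i, Quiver.Path x y) =>
        (⟨p.1.val, p.2.1.val, Below.path p.2.2⟩ : Σ x y : V, Quiver.Path x y)) hb) ?_)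
    rintro ⟨x, y, γ⟩ h
    have h : extend K i b x y γ ≠ 0 := h
    by_cases hx : comp x ≤ i
    · refine ⟨⟨⟨x, hx⟩, ⟨y, (comp_le_of_path γ).trans hx⟩, Below.lift hx γ⟩, fun h0 => h ?_, ?_⟩
      · rw [extend_apply_of_le K b hx]
        exact (congrArg (K.incl _) h0).trans (map_zero _)
      · simp only [Below.path_lift]
    · exact absurd (extend_apply_of_not_le K b hx γ) h
  · rw [hT] at hb ⊢
    set e : PathSeries K := diagSeries (idem K (Set.Iic i)) with he
    have heL : e ∈ rationalClosure (pathAlgebra K) := diagSeries_mem_rationalClosure _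
    have h1' : extend K i b * extend K i c = e := by rw [← extend_mul, h1, extend_one]
    have h2' : extend K i c * extend K i b = e := by rw [← extend_mul, h2, extend_one]
    have hee : e * e = e := by rw [he, ← extend_one, ← extend_mul, mul_one]
    have hel (s) : e * extend K i s = extend K i s := by
      rw [he, ← extend_one, ← extend_mul, one_mul]
    have her (s) : extend K i s * e = extend K i s := by
      rw [he, ← extend_one, ← extend_mul, mul_one]
    -- `extend` sends 1 only to the idempotent e. Adding 1 - e turns a unit of the corner into a
    -- unit of the whole ring, to which division closedness applies.
    have key : extend K i c + (1 - e) ∈ rationalClosure (pathAlgebra K) := by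
      refine isDivisionClosed_rationalClosure _ (extend K i b + (1 - e))
        (add_mem hb (sub_mem (one_mem _) heL)) _ ?_ ?_
      · simp only [mul_add, add_mul, mul_sub, sub_mul, mul_one, one_mul, h1', hel, her, hee]
        abel
      · simp only [mul_add, add_mul, mul_sub, sub_mul, mul_one, one_mul, h2', hel, her, hee]
        abel
    simpa using sub_mem key (sub_mem (one_mem _) heL)

theorem mul_mem_prodSpan {S : Type u} [Ring S] {A B : AddSubgroup S} {a b : S} (ha : a ∈ A)
    (hb : b ∈ B) : a * b ∈ prodSpan A B :=
  AddSubgroup.subset_closure ⟨a, ha, b, hb, rfl⟩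

theorem prodSpan_mono_right {S : Type u} [Ring S] (A : AddSubgroup S) {B B' : AddSubgroup S}
    (h : B ≤ B') : prodSpan A B ≤ prodSpan A B' :=
  AddSubgroup.closure_mono fun _ ⟨a, ha, b, hb, hab⟩ => ⟨a, ha, b, h hb, hab⟩

/-- Each path of r is absorbed by the left factor. Its coefficient, which lies in the field of a
component strictly below i and need not lie in K_i, goes to the right factor, which then starts at
the end of that path. -/
theorem mul_mul_mem_prodSpan {i : Comp V} {h r z : PathSeries K} (hh : h ∈ ratAt K i)
    (hr : r ∈ pathAlgebra K) (hri : ∀ (x y : V) (γ : Quiver.Path x y), r x y γ ≠ 0 →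
      comp x ≤ i ∧ comp y < i) (hz : z ∈ rationalClosure (pathAlgebra K)) :
    h * r * z ∈ prodSpan (ratAt K i) (ratOn K (Set.Iio i)) := by
  classical
  have hr : r.support.Finite := hr
  rw [eq_sum_single (a := r) (s := hr.toFinset) (by simp), Finset.mul_sum, Finset.sum_mul]
  refine sum_mem fun p hp => ?_
  obtain ⟨hx, hy⟩ := hri p.1 p.2.1 p.2.2 (hr.mem_toFinset.1 hp)
  rw [← mul_assoc, mul_assoc]
  refine mul_mem_prodSpan (mul_mem_ratAt K hh (single_mem_ratAt K hx))
    ⟨mul_mem (diagSeries_mem_rationalClosure _) hz, fun x y γ hx => ?_⟩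
  rw [diagSeries_mul_apply, Pi.single_eq_of_ne, map_zero, zero_mul]
  rintro rfl
  exact hx hy

/-- The part of a rational series starting in the component `i`. -/
theorem idem_mul_mem [∀ x y : V, Finite (x ⟶ y)] (i : Comp V) {a : PathSeries K}
    (ha : a ∈ rationalClosure (pathAlgebra K)) :
    diagSeries (idem K {i}) * a ∈
      ratAt K i ⊔ prodSpan (ratAt K i) (ratOn K (Set.Iio i)) := by
  rw [← ratSubring_eq_rationalClosure] at ha
  obtain ⟨p, _, _, B, X, c, d, hB, hB0, h1, h2, rfl⟩ := exists_normal_form ha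
  have hX (k l : p) : X k l ∈ rationalClosure (pathAlgebra K) := by
    rw [← ratSubring_eq_rationalClosure]
    refine apply_mem_ratSubring_of_inverse (fun j k => ?_) (augmentation K) (fun _ => rfl) h1 h2 k l
    refine sub_mem ?_ (map_mem_ratSubring _ _)
    rw [Matrix.one_apply]
    split_ifs
    · exact one_mem _
    · exact zero_mem _
  set q : PathSeries K := diagSeries (idem K {i}) with hq
  have hqq : q * q = q := by
    have := congrArg Subtype.val ((diag K).map_mul (idem K {i}) (idem K {i}))
    rw [idem_mul_idem] at this
    exact this.symm
  have hqd (k : ∀ x : V, K.fld (comp x)) : q * diagSeries k * q = q * diagSeries k := by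
    have h := congrArg Subtype.val (((diag K).map_mul (idem K {i}) k).symm.trans
      ((congrArg (diag K) (mul_comm _ _)).trans ((diag K).map_mul k (idem K {i}))))
    have h : q * diagSeries k = diagSeries k * q := h
    rw [mul_assoc, ← h, ← mul_assoc, hqq]
  have hlin {r : PathSeries K} (hr : ∀ (x y : V) (γ : Quiver.Path x y), 1 < γ.length →
      r x y γ = 0) : restr K i r ∈ fieldRat (Below i) (K.fld i) := by
    have : ∀ x y : Below i, Finite (x ⟶ y) := fun x y => inferInstanceAs (Finite (x.val ⟶ y.val))
    refine le_divisionClosure _ (mem_pathAlgebra_of_length fun x y γ h => ?_)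
    exact restr_apply_eq_zero K (hr _ _ _ (by rwa [Below.length_path]))
  have hdlin (k : ∀ x : V, K.fld (comp x)) :
      restr K i (diagSeries k) ∈ fieldRat (Below i) (K.fld i) :=
    hlin fun x y γ h => (pathLinearData K).sec_mem k x y γ h
  let B' : Matrix p p (FieldSeries (Below i) (K.fld i)) := Matrix.of fun j k => restr K i (B j k).1
  -- Division closedness over K_i suffices to invert 1 - q B q there, because its augmentation is 1.
  obtain ⟨Y, hY, -, hYB⟩ := invertsUnipotent_of_isDivisionClosed
    (isDivisionClosed_divisionClosure (pathAlgebra (V := Below i) (PosetOfFields.const _ (K.fld i))))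
    p (1 - B') (by
      intro j k
      refine sub_mem ?_ (hlin (hB j k))
      rw [Matrix.one_apply]
      split_ifs
      · exact one_mem _
      · exact zero_mem _) (by
      ext j k : 2
      have h : augmentation _ (B' j k) = 0 := by
        funext x
        exact restr_apply_eq_zero K (congrFun (hB0 j k) x.val)
      rw [Matrix.map_apply, Matrix.sub_apply, map_sub, h, sub_zero, Matrix.one_apply,
        Matrix.one_apply, apply_ite (augmentation _), map_one, map_zero])
  -- The part of c (1 - B)⁻¹ on paths that stay in the component i; it satisfies the recursion g = c
  -- + g B restricted to that component.
  let g : p → FieldSeries (Below i) (K.fld i) := fun k => ∑ j, restr K i (diagSeries (c j)) * Y j k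
  have hg (k : p) : g k ∈ fieldRat (Below i) (K.fld i) :=
    sum_mem fun j _ => mul_mem (hdlin _) (hY j k)
  have hgB (k : p) : g k = restr K i (diagSeries (c k)) + ∑ j, g j * B' j k := by
    have h : g = Matrix.vecMul (fun j => restr K i (diagSeries (c j))) Y := rfl
    have h3 : Matrix.vecMul g (1 - B') = fun j => restr K i (diagSeries (c j)) := by
      rw [h, Matrix.vecMul_vecMul, hYB, Matrix.vecMul_one]
    rw [Matrix.vecMul_sub, Matrix.vecMul_one] at h3
    rw [← congrFun h3 k, Pi.sub_apply]
    exact (sub_add_cancel _ _).symm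
  let G : p → PathSeries K := fun k => extend K i (g k)
  have hG (k : p) : G k ∈ ratAt K i := extend_mem_ratAt K (hg k)
  have hGB (k : p) : G k = q * diagSeries (c k) * q + ∑ j, G j * (q * (B j k).1 * q) := by
    have h : extend K i (restr K i (diagSeries (c k)) + ∑ j, g j * B' j k) =
        q * diagSeries (c k) * q + ∑ j, G j * (q * (B j k).1 * q) := by
      rw [map_add, map_sum, extend_restr]
      congr 1
      refine Finset.sum_congr rfl fun j _ => ?_
      rw [extend_mul, ← extend_restr]
      rfl
    rw [← h, ← hgB k]
  have hGq (k : p) : G k * q = G k := by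
    conv_rhs => rw [hGB k]
    conv_lhs => rw [hGB k]
    rw [add_mul, Finset.sum_mul]
    simp only [mul_assoc, hqq]
  -- The arrows of B that leave the component i.
  let N : Matrix p p (PathSeries K) := Matrix.of fun j k => q * (B j k).1 * (1 - q)
  -- A path starting in the component either stays in it or has a first exit. Algebraically, G (1 -
  -- B) + G N = q c, multiplied on the right by X.
  have hGN : Matrix.vecMul (fun k => q * diagSeries (c k)) X =
      G + Matrix.vecMul (Matrix.vecMul G N) X := by
    have h3 : Matrix.vecMul G (1 - B.map (pathAlgebra K).subtype) + Matrix.vecMul G N =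
        fun k => q * diagSeries (c k) := by
      rw [Matrix.vecMul_sub, Matrix.vecMul_one]
      funext k
      rw [Pi.add_apply, Pi.sub_apply]
      simp only [Matrix.vecMul, dotProduct]
      conv_lhs => rw [hGB k]
      have h4 (j : p) : G j * N j k = G j * (B j k).1 - G j * (q * (B j k).1 * q) := by
        change G j * (q * (B j k).1 * (1 - q)) = _
        rw [mul_sub (q * (B j k).1), mul_one, mul_sub, ← mul_assoc (G j) q, hGq]
      simp only [h4, Finset.sum_sub_distrib, hqd]
      simp only [Matrix.map_apply, Subring.subtype_apply]
      abel
    rw [← h3, Matrix.add_vecMul, Matrix.vecMul_vecMul, h1, Matrix.vecMul_one]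
  have hsum : q * ∑ k, ∑ l, (pathAlgebra K).subtype ((pathLinearData K).sec (c k)) * X k l *
      (pathAlgebra K).subtype ((pathLinearData K).sec (d l)) =
      dotProduct (Matrix.vecMul (fun k => q * diagSeries (c k)) X) (fun l => diagSeries (d l)) := by
    simp only [dotProduct, Matrix.vecMul, Finset.sum_mul, Finset.mul_sum]
    rw [Finset.sum_comm]
    simp only [← mul_assoc]
    rfl
  rw [hsum, hGN, add_dotProduct]
  refine AddSubgroup.add_mem_sup ?_ ?_
  · refine sum_mem fun l _ => ?_
    -- G ends in the component i, so d may be replaced by q d q, which comes from E_{I↓i}.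
    rw [← hGq, mul_assoc, ← hqd, ← extend_restr]
    exact mul_mem_ratAt K (hG l) (extend_mem_ratAt K (hdlin _))
  · simp only [dotProduct, Matrix.vecMul, Finset.sum_mul]
    refine sum_mem fun l _ => sum_mem fun k _ => sum_mem fun j _ => ?_
    rw [mul_assoc]
    refine mul_mul_mem_prodSpan (hG j) ?_ (fun x y γ h => ?_)
      (mul_mem (hX k l) (diagSeries_mem_rationalClosure _))
    · exact mul_mem (mul_mem (diagSeries_mem_pathAlgebra _) (B j k).2)
        (sub_mem (one_mem _) (diagSeries_mem_pathAlgebra _))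
    · have h : N j k x y γ ≠ 0 := h
      have hN : N j k x y γ = K.incl (comp_le_of_path γ) (idem K {i} x) * (B j k).1 x y γ *
          (1 - idem K {i} y) := by
        change (q * (B j k).1 * (1 - q)) x y γ = _
        rw [mul_sub, mul_one, PathSeries.sub_apply, mul_diagSeries_apply, diagSeries_mul_apply,
          mul_sub, mul_one]
      have hx : comp x = i := by
        by_contra hx
        rw [hN, idem_of_notMem hx, map_zero, zero_mul, zero_mul] at h
        exact h rfl
      have hy : comp y ≠ i := by
        intro hy
        rw [hN, idem_of_mem (x := y) hy, sub_self, mul_zero] at h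
        exact h rfl
      exact ⟨hx.le, lt_of_le_of_ne (hx ▸ comp_le_of_path γ) hy⟩

-- Start from one minimal component and adjoin minimal elements of the complement, by induction on
-- its cardinality.
variable (K) in
theorem exists_isRat_univ [Nonempty (Comp V)] : ∃ P, IsRat K Set.univ P := by
  have := finite_comp (V := V)
  have key : ∀ (n : ℕ) (J : Set (Comp V)) (P : AddSubgroup (PathSeries K)), Jᶜ.ncard = n →
      J.Nonempty → IsLowerSet J → IsRat K J P → ∃ P, IsRat K Set.univ P := by
    intro n
    induction n with
    | zero =>
      intro J P hn _ _ hP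
      rw [Set.ncard_eq_zero (Set.toFinite _), Set.compl_empty_iff] at hn
      exact ⟨P, hn ▸ hP⟩
    | succ n ih =>
      intro J P hn hne hlow hP
      obtain ⟨i, hi⟩ := (Set.toFinite Jᶜ).exists_minimal
        (Set.nonempty_of_ncard_ne_zero (by omega))
      refine ih (J ∪ {i}) _ ?_ (hne.mono Set.subset_union_left) ?_ (.step J hne hlow i hi P hP)
      · have h : (J ∪ {i})ᶜ = Jᶜ \ {i} := by
          ext j; simp [and_comm]
        rw [h, Set.ncard_sdiff_singleton_of_mem hi.prop, hn]
        rfl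
      · rintro a b hba (ha | rfl)
        · exact Or.inl (hlow hba ha)
        · by_cases hb : b ∈ J
          · exact Or.inl hb
          · exact Or.inr (le_antisymm hba (hi.le_of_le hb hba))
  obtain ⟨m, hm⟩ := (Set.toFinite (Set.univ : Set (Comp V))).exists_minimal Set.univ_nonempty
  have hm' : IsMin m := fun j hj => hm.le_of_le trivial hj
  refine key _ {m} _ rfl (Set.singleton_nonempty m) ?_
    (.base {m} (Set.singleton_nonempty m) (by rintro _ rfl; exact hm'))
  rintro a b hba rfl
  exact le_antisymm hba (hm' hba)

variable [∀ x y : V, Finite (x ⟶ y)]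

/-- Below a minimal i there are no sources left, so the product term in `idem_mul_mem` vanishes;
summing over source components gives the result. -/
theorem iSup_ratAt_eq_ratOn {J : Set (Comp V)} (hJ : ∀ i ∈ J, IsMin i) :
    ⨆ i ∈ J, ratAt K i = ratOn K J := by
  apply le_antisymm
  · refine iSup₂_le fun i hi => (ratAt_le_ratOn i).trans (ratOn_mono fun j hj => ?_)
    rwa [le_antisymm hj (hJ i hi hj)]
  · intro a ha
    have := finite_comp (V := V)
    have := Fintype.ofFinite (Comp V)
    rw [← sum_idem_mul a]
    refine sum_mem fun i _ => ?_
    by_cases hi : i ∈ J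
    · have h0 : prodSpan (ratAt K i) (ratOn K (Set.Iio i)) = ⊥ := by
        rw [eq_bot_iff, prodSpan, AddSubgroup.closure_le]
        rintro _ ⟨b, -, c, hc, rfl⟩
        have hc : c = 0 := by
          ext x y γ
          exact hc.2 x y γ fun hx => (hJ i hi).not_lt (Set.mem_Iio.1 hx)
        rw [hc, mul_zero]
        exact zero_mem _
      have h := idem_mul_mem i ha.1
      rw [h0, sup_bot_eq] at h
      exact AddSubgroup.mem_iSup_of_mem i (AddSubgroup.mem_iSup_of_mem hi h)
    · have h : diagSeries (idem K {i}) * a = 0 := by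
        ext x y γ
        rw [diagSeries_mul_apply]
        by_cases hx : comp x = i
        · rw [ha.2 x y γ (hx ▸ hi), mul_zero, PathSeries.zero_apply]
        · rw [idem_of_notMem hx, map_zero, zero_mul, PathSeries.zero_apply]
      rw [h]
      exact zero_mem _

/-- Minimality of i puts everything strictly below i into J. A series is split into its part
starting in the component i, handled by `idem_mul_mem`, and the remainder, which starts in J. -/
theorem ratAt_sup_prodSpan_sup_eq_ratOn {J : Set (Comp V)} {i : Comp V}
    (hi : Minimal (fun j => j ∉ J) i) :
    ratAt K i ⊔ prodSpan (ratAt K i) (ratOn K J) ⊔ ratOn K J = ratOn K (J ∪ {i}) := by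
  have hlt : Set.Iio i ⊆ J := fun j hj => by
    by_contra h
    exact hi.not_prop_of_lt hj h
  have hle : Set.Iic i ⊆ J ∪ {i} := fun j hj =>
    (lt_or_eq_of_le (Set.mem_Iic.1 hj)).imp (fun h => hlt h) fun h => h
  have hat : ratAt K i ≤ ratOn K (J ∪ {i}) := (ratAt_le_ratOn i).trans (ratOn_mono hle)
  apply le_antisymm
  · refine sup_le (sup_le hat ?_) (ratOn_mono Set.subset_union_left)
    rw [prodSpan, AddSubgroup.closure_le]
    rintro _ ⟨a, ha, b, hb, rfl⟩
    exact mul_mem_ratOn (hat ha) hb.1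
  · intro a ha
    rw [← add_sub_cancel (diagSeries (idem K {i}) * a) a]
    refine AddSubgroup.add_mem_sup (sup_le_sup_left (prodSpan_mono_right _ (ratOn_mono hlt)) _
      (idem_mul_mem i ha.1)) ⟨sub_mem ha.1 (mul_mem (diagSeries_mem_rationalClosure _) ha.1), ?_⟩
    intro x y γ hx
    rw [PathSeries.sub_apply, diagSeries_mul_apply]
    by_cases hxi : comp x = i
    · rw [idem_of_mem hxi, map_one, one_mul, sub_self]
    · rw [idem_of_notMem hxi, map_zero, zero_mul, sub_zero, ha.2 x y γ (by simp [hx, hxi])]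

/-- The right side depends on J alone, which is the independence of the choices in the induction. -/
theorem IsRat.eq_ratOn {J : Set (Comp V)} {P : AddSubgroup (PathSeries K)} (h : IsRat K J P) :
    P = ratOn K J := by
  induction h with
  | base J _ hmin => exact iSup_ratAt_eq_ratOn hmin
  | step J _ _ i hi P _ ih => rw [ih, ratAt_sup_prodSpan_sup_eq_ratOn hi]

end RationalSeries

end PosetFields

open PosetFields in
theorem mainTheorem3 {V : Type u} [Quiver.{v} V] [Finite V] [∀ x y : V, Finite (x ⟶ y)]
    [Preorder V] [PathCompatible V] (hI : IsTreePoset (Comp V))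
    (K : PosetOfFields.{u, w} (Comp V)) :
    ∃ Prat : Subring (PathSeries K),
      -- `Prat` is `P^rat_K(E)`: the one and only value of `P^rat_J(E)` at `J = I`
      (∀ P : AddSubgroup (PathSeries K), IsRat K Set.univ P ↔ P = Prat.toAddSubgroup) ∧
      -- it is the rational closure of `P_K(E)` in `P_K((E))`
      Prat = rationalClosure (pathAlgebra K) ∧
      -- the natural map `P_K(E) Σ⁻¹ → P^rat_K(E)` is an isomorphism
      ∃ φ : UnivLoc (pathAlgebra K) (sigmaSet K) →+* Prat,
        (∀ r : pathAlgebra K, (φ (UnivLoc.of (sigmaSet K) r) : PathSeries K) = r) ∧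
        (∀ ψ : UnivLoc (pathAlgebra K) (sigmaSet K) →+* Prat,
          (∀ r : pathAlgebra K, (ψ (UnivLoc.of (sigmaSet K) r) : PathSeries K) = r) → ψ = φ) ∧
        Function.Bijective φ := by
  refine ⟨rationalClosure (pathAlgebra K), fun P => ?_, rfl, exists_univLoc_bijective K⟩
  rw [← ratOn_univ]
  refine ⟨IsRat.eq_ratOn, ?_⟩
  rintro rfl
  -- The maximum provides a component, so that the induction can start and a value at J = I exists.
  obtain ⟨i₀, -⟩ := hI
  have : Nonempty (Comp V) := ⟨i₀⟩
  obtain ⟨P, hP⟩ := exists_isRat_univ K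
  exact hP.eq_ratOn ▸ hP
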